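/- **Setting.** Let $P$ be a simple polygon (closed region, vertices $p_1,\dots,p_n$ in counterclockwise order) and let $\theta$ be a direction. Two points of $P$ *$\theta$-see* each other if they are joined by a path in $P$ that meets every line parallel to $\theta$ in a connected set. A *watchman tour* is a closed polygonal tour inside $P$ such that every point of $P$ is $\theta$-seen from some point of the tour; $T(\theta)$ denotes a shortest one and $|T(\theta)|$ its length. (It need not be unique; the statement holds for every choice.) A reflex vertex $v$ is *coloured* if both its incident edges lie strictly on the same side of the line $l$ through $v$ with direction $\theta$. The maximal segment $s\subset l\cap P$ through $v$ then gives two *$\theta$-cuts* issued by $v$: the portion of $s$ bounding the component of $P\setminus s$ that contains the edge leaving $v$ (forward cut), and the portion bounding the component that contains the edge entering $v$ (backward cut). For a cut $c$ let $L(c)$ be $P$ minus that component. A cut $c$ is a *gate* if there is no $\theta$-cut $c'$ with $L(c')\subsetneq L(c)$; its *gate vertex* is $v$, and its *gate edge* is an edge of $P$, not parallel to $\theta$, that contains the other endpoint of $c$. Let $G(\theta)$ be the set of gates met by $T(\theta)$. Each vertex of $T(\theta)$ is either *stable* (a reflex vertex of $P$) or *moving*; a moving vertex lies on a gate in $G(\theta)$,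 either at the endpoint on the gate edge, or in the relative interior of the gate and in the interior of $P$, where the tour turns. Distinct moving vertices belong to distinct gates. (A tour that consists of a single point may also be regarded as having no vertices.) The *itinerary* of $T(\theta)$ is the cyclic sequence that lists, in the order of the tour, the stable vertices and, for each moving vertex, its gate vertex and whether the gate is touched in its interior or at its gate edge, in the latter case together with this gate edge. Tours $T(\theta)$ and $T(\theta+\varepsilon)$ are *close* if 1. their itineraries are the same, and 2. the gates of $G(\theta)$ and $G(\theta+\varepsilon)$ correspond to each other: each gate of one set has a counterpart in the other set with the same gate vertex and the same gate edge, such that $T(\theta)$ touches the gate vertex if and only if $T(\theta+\varepsilon)$ does, and $T(\theta)$ touches the other endpoint of the gate if and only if $T(\theta+\varepsilon)$ touches the other endpoint of its counterpart. **Lemma.** Let $\cos\varepsilon\neq0$. If $T(\theta)$ and $T(\theta+\varepsilon)$ are close, then $$|T(\theta+\varepsilon)|=|T(\theta)|+\sum_{k=1}^{|G(\theta)|}f_k(\varepsilon),$$ where $$\begin{aligned}f_k(\varepsilon)={}&\sqrt{\frac{a_{k,0}^2+a_{k,1}\tan\varepsilon+a_{k,2}\tan^2\varepsilon}{1+a_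{k,3}\tan\varepsilon+a_{k,4}\tan^2\varepsilon}}-a_{k,0}+\sqrt{\frac{a_{k,5}^2+a_{k,6}\tan\varepsilon+a_{k,7}\tan^2\varepsilon}{1+a_{k,8}\tan\varepsilon+a_{k,9}\tan^2\varepsilon}}-a_{k,5}\\&+\sqrt{\frac{a_{k,10}^2+\sum_{i=1}^{4}a_{k,10+i}\tan^i\varepsilon}{1+\sum_{i=1}^{4}a_{k,14+i}\tan^i\varepsilon}}-a_{k,10}+\sqrt{\frac{a_{k,19}^2+\sum_{i=1}^{14}a_{k,19+i}\tan^i\varepsilon}{1+\sum_{i=1}^{14}a_{k,33+i}\tan^i\varepsilon}}-a_{k,19},\end{aligned}$$ all denominators are nonzero and all radicands are nonnegative, and the constants $a_{k,0},\dots,a_{k,47}$ depend only on $\theta$ and on the itinerary of $T(\theta)$, that is, on its stable vertices, gate vertices and touched gate edges in the order of the tour (and not on $\varepsilon$ or on the rest of the polygon). -/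

import Mathlib

noncomputable section

namespace MonotoneWatchman

/-! ### The plane -/

abbrev Plane : Type := EuclideanSpace ℝ (Fin 2)

/-- The planar cross product; `0 < cross u w` means that `w` points to the left of `u`. -/
def cross (u w : Plane) : ℝ := u 0 * w 1 - u 1 * w 0

/-- The unit vector with angle `θ` to the `x`-axis. -/
def dir (θ : ℝ) : Plane := !₂[Real.cos θ, Real.sin θ]

/-- The line with direction `θ` through `p`. -/
def lineThrough (θ : ℝ) (p : Plane) : Set Plane := {x | cross (dir θ) (x - p) = 0}

/-! ### Simple polygons -/

/-- A simple polygon, given by its vertices in counterclockwise order (indices are cyclic). -/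
structure SimplePolygon (n : ℕ) [NeZero n] where
  vertex : Fin n → Plane
  three_le : 3 ≤ n
  vertex_injective : Function.Injective vertex
  /-- Consecutive edges meet in their common vertex only. -/
  consecutive : ∀ i : Fin n,
    segment ℝ (vertex i) (vertex (i + 1)) ∩ segment ℝ (vertex (i + 1)) (vertex (i + 1 + 1))
      = {vertex (i + 1)}
  /-- All other pairs of edges are disjoint. -/
  nonconsecutive : ∀ i j : Fin n, i ≠ j → j ≠ i + 1 → i ≠ j + 1 →
    Disjoint (segment ℝ (vertex i) (vertex (i + 1))) (segment ℝ (vertex j) (vertex (j + 1)))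
  /-- The signed area is positive. -/
  counterclockwise : 0 < ∑ i : Fin n, cross (vertex i) (vertex (i + 1))

namespace SimplePolygon

variable {n : ℕ} [NeZero n]

/-- The edge from vertex `i` to vertex `i + 1`. -/
def edge (P : SimplePolygon n) (i : Fin n) : Set Plane :=
  segment ℝ (P.vertex i) (P.vertex (i + 1))

def boundary (P : SimplePolygon n) : Set Plane := ⋃ i : Fin n, P.edge i

/-- The polygon as a closed region: the boundary curve together with the points that it encloses,
i.e. those whose component in the complement of the curve is bounded. -/
def region (P : SimplePolygon n) : Set Plane :=
  P.boundary ∪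
    {x | x ∉ P.boundary ∧ Bornology.IsBounded (connectedComponentIn P.boundaryᶜ x)}

/-- The interior angle at vertex `i` is larger than `π`. -/
def IsReflex (P : SimplePolygon n) (i : Fin n) : Prop :=
  cross (P.vertex i - P.vertex (i - 1)) (P.vertex (i + 1) - P.vertex i) < 0

end SimplePolygon

variable {n : ℕ} [NeZero n] {m : ℕ} [NeZero m]

/-! ### Monotone visibility and shortest watchman tours -/

/-- A set (the trace of a path) is `θ`-monotone: every line parallel to direction `θ` meets it in
a connected (possibly empty) set. -/
def IsMonotone (θ : ℝ) (S : Set Plane) : Prop :=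
  ∀ p : Plane, IsPreconnected (S ∩ lineThrough θ p)

/-- `p` and `q` `θ`-see each other in `P`. -/
def Sees (P : SimplePolygon n) (θ : ℝ) (p q : Plane) : Prop :=
  ∃ γ : Path p q, Set.range γ ⊆ P.region ∧ IsMonotone θ (Set.range γ)

/-- The trace of the closed polygonal tour `T 0, T 1, …, T (m - 1), T 0`. -/
def trace (T : Fin m → Plane) : Set Plane := ⋃ i : Fin m, segment ℝ (T i) (T (i + 1))

/-- The length of the closed polygonal tour. -/
def tourLength (T : Fin m → Plane) : ℝ := ∑ i : Fin m, dist (T i) (T (i + 1))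

/-- The tour stays inside `P`, and every point of `P` is `θ`-seen from a point of the tour. -/
def IsWatchmanTour (P : SimplePolygon n) (θ : ℝ) (T : Fin m → Plane) : Prop :=
  trace T ⊆ P.region ∧ ∀ q ∈ P.region, ∃ p ∈ trace T, Sees P θ p q

/-- A shortest (floating) watchman tour under `θ`-monotone visibility. -/
def IsShortestWatchmanTour (P : SimplePolygon n) (θ : ℝ) (T : Fin m → Plane) : Prop :=
  IsWatchmanTour P θ T ∧
    ∀ (l : ℕ) [NeZero l] (S : Fin l → Plane), IsWatchmanTour P θ S → tourLength T ≤ tourLength S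

/-! ### Cuts and gates -/

inductive CutSide : Type
  | forward : CutSide
  | backward : CutSide

/-- A cut is named by its issuing vertex and its side. -/
abbrev CutName (n : ℕ) : Type := Fin n × CutSide

/-- Vertex `i` is coloured: it is reflex, and both incident edges lie strictly on the same side of
the line with direction `θ` through it (to the right: red; to the left: blue). -/
def IsColoured (P : SimplePolygon n) (θ : ℝ) (i : Fin n) : Prop :=
  P.IsReflex i ∧
    0 < cross (dir θ) (P.vertex (i + 1) - P.vertex i) * cross (dir θ) (P.vertex (i - 1) - P.vertex i)

/-- The maximal segment with direction `θ` through vertex `i` inside the polygon. -/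
def maxSegment (P : SimplePolygon n) (θ : ℝ) (i : Fin n) : Set Plane :=
  connectedComponentIn (P.region ∩ lineThrough θ (P.vertex i)) (P.vertex i)

/-- The part of the polygon to the right of a cut. The maximal segment through the (coloured)
vertex splits the polygon. The forward cut bounds the component that contains the edge leaving the
vertex in counterclockwise order, the backward cut the one that contains the edge entering it.
Apart from the vertex itself these edges do not meet the line of the cut. -/
def rightPart (P : SimplePolygon n) (θ : ℝ) : CutName n → Set Plane
  | (i, CutSide.forward) =>
      connectedComponentIn (P.region \ maxSegment P θ i) (P.vertex (i + 1))
  | (i, CutSide.backward) =>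
      connectedComponentIn (P.region \ maxSegment P θ i) (P.vertex (i - 1))

/-- The part of the polygon to the left of a cut (the cut included). -/
def leftPart (P : SimplePolygon n) (θ : ℝ) (c : CutName n) : Set Plane :=
  P.region \ rightPart P θ c

/-- The cut as a point set: the portion of the maximal segment that bounds the right part. -/
def cutSet (P : SimplePolygon n) (θ : ℝ) (c : CutName n) : Set Plane :=
  maxSegment P θ c.1 ∩ closure (rightPart P θ c)

/-- A gate is a `θ`-cut that no other `θ`-cut dominates; `c'` dominates `c` if the left part of
`c'` is properly contained in the left part of `c`. -/
def IsGate (P : SimplePolygon n) (θ : ℝ) (c : CutName n) : Prop :=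
  IsColoured P θ c.1 ∧
    ∀ c' : CutName n, IsColoured P θ c'.1 → ¬ leftPart P θ c' ⊂ leftPart P θ c

/-- `E` is the endpoint of the cut opposite to its issuing vertex. -/
def IsFarEnd (P : SimplePolygon n) (θ : ℝ) (c : CutName n) (E : Plane) : Prop :=
  E ≠ P.vertex c.1 ∧ cutSet P θ c = segment ℝ (P.vertex c.1) E

/-- Edge `e` is a gate edge of `c`: the far end of `c` lies on `e`, and `e` is not parallel to the
cut. (The edge is unique unless the far end is a vertex of the polygon.) -/
def IsGateEdge (P : SimplePolygon n) (θ : ℝ) (c : CutName n) (e : Fin n) : Prop :=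
  (∃ E ∈ P.edge e, IsFarEnd P θ c E) ∧ cross (dir θ) (P.vertex (e + 1) - P.vertex e) ≠ 0

/-- The set of gates visited by the tour `T`. -/
def visitedGates (P : SimplePolygon n) (θ : ℝ) (T : Fin m → Plane) : Set (CutName n) :=
  {c | IsGate P θ c ∧ (cutSet P θ c ∩ trace T).Nonempty}

/-! ### Stable and moving vertices of a tour -/

/-- The local description of one vertex of a tour: a stable vertex at the point `w`; a moving vertex
in the relative interior of the gate with gate vertex `v`; a moving vertex at the far end of the
gate with gate vertex `v` and gate edge from `a` to `b`; or (`point`) the only point of a tour of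
length zero, which has no proper vertices. -/
inductive Stop : Type
  | point : Stop
  | stable (w : Plane) : Stop
  | inner (v : Plane) : Stop
  | farEnd (v a b : Plane) : Stop

def Stop.IsMoving : Stop → Prop
  | Stop.point => False
  | Stop.stable _ => False
  | Stop.inner _ => True
  | Stop.farEnd _ _ _ => True

/-- `s` describes vertex `i` of the tour `T`, the cut `c` being the gate that is touched there if
the vertex is a moving one. A moving vertex in the relative interior of a gate is an interior point
of the polygon, and the tour really turns there. -/
def DescribesVertex (P : SimplePolygon n) (θ : ℝ) (T : Fin m → Plane) (i : Fin m)
    (c : CutName n) : Stop → Prop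
  | Stop.point => m = 1
  | Stop.stable w => T i = w ∧ ∃ j : Fin n, P.IsReflex j ∧ P.vertex j = w
  | Stop.inner v => P.vertex c.1 = v ∧ c ∈ visitedGates P θ T ∧ T i ∈ cutSet P θ c ∧
      T i ∈ interior P.region ∧ T i ∉ segment ℝ (T (i - 1)) (T (i + 1))
  | Stop.farEnd v a b => P.vertex c.1 = v ∧ c ∈ visitedGates P θ T ∧ IsFarEnd P θ c (T i) ∧
      ∃ e : Fin n, IsGateEdge P θ c e ∧ P.vertex e = a ∧ P.vertex (e + 1) = b

/-- `R` lists the stable and the moving vertices of the tour `T` in the order of the tour.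
Consecutive vertices are distinct (unless the tour is a single point), and each visited gate
carries at most one moving vertex (the gates act as mirrors, each being used once). -/
def IsItinerary (P : SimplePolygon n) (θ : ℝ) (T : Fin m → Plane) (R : Fin m → Stop) : Prop :=
  (m = 1 ∨ ∀ i, T i ≠ T (i + 1)) ∧
    ∃ g : Fin m → CutName n, Set.InjOn g {i | (R i).IsMoving} ∧
      ∀ i, DescribesVertex P θ T i (g i) (R i)

/-! ### Close tours -/

/-- The gates `c` (for direction `θ`) and `c'` (for direction `θ'`) have the same gate vertex and a
common gate edge, `T` touches the gate vertex iff `T'` does, and `T` touches the far end of `c` iff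
`T'` touches the far end of `c'`. -/
def GatesCorrespond (P : SimplePolygon n) (θ θ' : ℝ) (T T' : Fin m → Plane)
    (c c' : CutName n) : Prop :=
  c.1 = c'.1 ∧
  (∃ e : Fin n, IsGateEdge P θ c e ∧ IsGateEdge P θ' c' e) ∧
  (P.vertex c.1 ∈ trace T ↔ P.vertex c'.1 ∈ trace T') ∧
  (∀ E E' : Plane, IsFarEnd P θ c E → IsFarEnd P θ' c' E' → (E ∈ trace T ↔ E' ∈ trace T'))

/-- Closeness of the tour `T` for direction `θ`, with itinerary `R`, and the tour `T'` for direction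
`θ'`, with itinerary `R'`: the itineraries agree as cyclic sequences, and the gates visited by the
two tours correspond to each other. -/
def Close (P : SimplePolygon n) (θ θ' : ℝ) (T : Fin m → Plane) (R : Fin m → Stop)
    (T' : Fin m → Plane) (R' : Fin m → Stop) : Prop :=
  (∃ k : Fin m, ∀ i, R' i = R (i + k)) ∧
  (∀ c ∈ visitedGates P θ T, ∃ c' ∈ visitedGates P θ' T', GatesCorrespond P θ θ' T T' c c') ∧
  (∀ c' ∈ visitedGates P θ' T', ∃ c ∈ visitedGates P θ T, GatesCorrespond P θ θ' T T' c c')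

/-! ### The change function -/

/-- `a o ^ 2 + a (o + 1) * t + ⋯ + a (o + D) * t ^ D` -/
def numer (a : ℕ → ℝ) (o D : ℕ) (t : ℝ) : ℝ :=
  a o ^ 2 + ∑ i ∈ Finset.Icc 1 D, a (o + i) * t ^ i

/-- `1 + a (o + D + 1) * t + ⋯ + a (o + D + D) * t ^ D` -/
def denom (a : ℕ → ℝ) (o D : ℕ) (t : ℝ) : ℝ :=
  1 + ∑ i ∈ Finset.Icc 1 D, a (o + D + i) * t ^ i

/-- One summand `√(numer / denom) - a o`. -/
def rootTerm (a : ℕ → ℝ) (o D : ℕ) (t : ℝ) : ℝ :=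
  Real.sqrt (numer a o D t / denom a o D t) - a o

/-- The denominator does not vanish and the radicand is not negative. -/
def RootTermDefined (a : ℕ → ℝ) (o D : ℕ) (t : ℝ) : Prop :=
  denom a o D t ≠ 0 ∧ 0 ≤ numer a o D t / denom a o D t

/-- The contribution of one gate, with constants `a 0, …, a 47`. -/
def gateTerm (a : ℕ → ℝ) (ε : ℝ) : ℝ :=
  rootTerm a 0 2 (Real.tan ε) + rootTerm a 5 2 (Real.tan ε) + rootTerm a 10 4 (Real.tan ε)
    + rootTerm a 19 14 (Real.tan ε)

def GateTermDefined (a : ℕ → ℝ) (ε : ℝ) : Prop :=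
  RootTermDefined a 0 2 (Real.tan ε) ∧ RootTermDefined a 5 2 (Real.tan ε) ∧
    RootTermDefined a 10 4 (Real.tan ε) ∧ RootTermDefined a 19 14 (Real.tan ε)

end MonotoneWatchman

end

open MonotoneWatchman

noncomputable section

namespace MonotoneWatchman

variable {n : ℕ} [NeZero n] {m : ℕ} [NeZero m]

/-! ### Tours as closed sequences -/

/-! The itinerary and the direction determine the length of a shortest tour through algebraic
equations (`Obeys`). A stable vertex is fixed, and a far end is the intersection of two known lines.
At an inner vertex on a gate the tour satisfies the law of reflection: sliding such a vertex along
the direction of monotonicity inside a small disc keeps the tour a watchman tour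
(`IsWatchmanTour.exists_slide`), so the sum of the distances to its neighbours is stationary.

Scaled by the inverse cosine, the direction `θ + ε` is linear in `t = tan ε`. The coordinate across
it is then a known linear polynomial in `t` at every vertex, inner ones included, because a vertex
on a gate shares it with the gate vertex. The coordinate along it is a rational function at every
vertex that is not inner. A run of inner vertices unfolds to a straight path between its two ends,
so all its sides have the same slope up to sign, a quotient of a net displacement by an alternating
sum of linear polynomials (`alternating_slope`, `hasSlope_of_isInner`). Hence each side has as
length the square root of a rational function of `t`, and so has the sum of the two sides at a
reflection.

Each side with a moving endpoint is charged to one moving vertex, and distinct moving vertices use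
distinct visited gates. Surplus gates contribute zero. A side between stable vertices does not
change. -/

lemma natCast_val_nsmul_one (j : Fin m) : (j : ℕ) • (1 : Fin m) = j := by
  open scoped Fin.CommRing in simp

lemma card_nsmul_one : m • (1 : Fin m) = 0 := by
  simpa using card_nsmul_eq_zero (x := (1 : Fin m))

lemma sum_fin_eq_sum_range_nsmul (f : Fin m → ℝ) (i : Fin m) :
    ∑ j, f j = ∑ j ∈ Finset.range m, f (i + j • 1) := by
  rw [Finset.sum_range, ← Equiv.sum_comp (Equiv.addLeft i) f]
  simp [natCast_val_nsmul_one]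

lemma tourLength_eq_sum_range (T : Fin m → Plane) (i : Fin m) :
    tourLength T = ∑ j ∈ Finset.range m, dist (T (i + j • 1)) (T (i + (j + 1) • 1)) := by
  rw [tourLength, sum_fin_eq_sum_range_nsmul _ i]
  simp [succ_nsmul, add_assoc]

lemma mem_trace_iff_exists_nsmul (T : Fin m → Plane) (i : Fin m) (z : Plane) :
    z ∈ trace T ↔ ∃ j < m, z ∈ segment ℝ (T (i + j • 1)) (T (i + (j + 1) • 1)) := by
  simp only [trace, Set.mem_iUnion]
  constructor
  · rintro ⟨j, hj⟩
    refine ⟨(j - i : Fin m), Fin.is_lt _, ?_⟩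
    rw [succ_nsmul, natCast_val_nsmul_one]
    simpa [← add_assoc] using hj
  · rintro ⟨j, -, hj⟩
    exact ⟨i + j • 1, by simpa [succ_nsmul, add_assoc] using hj⟩

lemma apply_val_add_one {α : Type*} {f : ℕ → α} (hf : f m = f 0) (j : Fin m) :
    f ((j + 1 : Fin m) : ℕ) = f (j + 1) := by
  have hj := j.is_lt
  rw [Fin.val_add, Fin.val_one']
  rcases Nat.lt_or_ge 1 m with h | h
  · rw [Nat.mod_eq_of_lt h]
    rcases Nat.lt_or_ge (j + 1) m with h' | h'
    · rw [Nat.mod_eq_of_lt h']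
    · have : (j : ℕ) + 1 = m := by omega
      rw [this, Nat.mod_self, hf]
  · have h1 : m = 1 := by omega
    have h2 : (j : ℕ) = 0 := by omega
    rw [h2, zero_add]
    subst h1
    simp [hf]

lemma tourLength_val {f : ℕ → Plane} (hf : f m = f 0) :
    tourLength (fun j : Fin m => f j) = ∑ j ∈ Finset.range m, dist (f j) (f (j + 1)) := by
  rw [tourLength, Finset.sum_range]
  exact Finset.sum_congr rfl fun j _ => by rw [apply_val_add_one hf]

lemma mem_trace_val {f : ℕ → Plane} (hf : f m = f 0) (z : Plane) :
    z ∈ trace (fun j : Fin m => f j) ↔ ∃ j < m, z ∈ segment ℝ (f j) (f (j + 1)) := by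
  simp only [trace, Set.mem_iUnion, apply_val_add_one hf]
  exact ⟨fun ⟨j, hj⟩ => ⟨j, j.is_lt, hj⟩, fun ⟨j, h, hj⟩ => ⟨⟨j, h⟩, hj⟩⟩

/-! ### Sliding a corner of a tour along the direction of monotonicity -/

lemma cross_add (d u w : Plane) : cross d (u + w) = cross d u + cross d w := by
  simp [cross]; ring

lemma cross_sub (d u w : Plane) : cross d (u - w) = cross d u - cross d w := by
  simp [cross]; ring

lemma cross_smul (d : Plane) (c : ℝ) (u : Plane) : cross d (c • u) = c * cross d u := by
  simp [cross]; ring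

lemma smul_cross (c : ℝ) (d u : Plane) : cross (c • d) u = c * cross d u := by
  simp [cross]; ring

lemma segment_subset_lineThrough {θ : ℝ} {p a b : Plane} (ha : a ∈ lineThrough θ p)
    (hb : b ∈ lineThrough θ p) : segment ℝ a b ⊆ lineThrough θ p := by
  rintro _ ⟨s, t, -, -, hst, rfl⟩
  simp only [lineThrough, Set.mem_ofPred_eq, cross_sub, cross_add, cross_smul] at *
  linear_combination s * ha + t * hb + cross (dir θ) p * hst

/-- A point sees whatever is seen from a point next to it in the direction `θ`. -/
lemma Sees.of_segment {P : SimplePolygon n} {θ : ℝ} {p p' q : Plane} (h : Sees P θ p q)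
    (hs : segment ℝ p' p ⊆ P.region) (hp : cross (dir θ) (p' - p) = 0) : Sees P θ p' q := by
  obtain ⟨γ, hγ, hmono⟩ := h
  refine ⟨(Path.segment p' p).trans γ, ?_, ?_⟩
  · rw [Path.trans_range, Path.range_segment]
    exact Set.union_subset hs hγ
  · intro o
    rw [Path.trans_range, Path.range_segment, Set.union_inter_distrib_right]
    have hpp : p ∈ lineThrough θ o ↔ p' ∈ lineThrough θ o := by
      simp only [lineThrough, Set.mem_ofPred_eq, cross_sub] at *
      constructor <;> intro h <;> linarith
    -- The added segment is parallel to `θ`. A line of that direction either contains it, and then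
    -- the segment and the trace of `γ` on the line share `p`, or misses it altogether.
    by_cases hpo : p ∈ lineThrough θ o
    · have hsub := segment_subset_lineThrough (hpp.1 hpo) hpo
      rw [Set.inter_eq_left.2 hsub]
      exact IsPreconnected.union p (right_mem_segment ℝ p' p) ⟨⟨0, γ.source⟩, hpo⟩
        (convex_segment p' p).isPreconnected (hmono o)
    · have : segment ℝ p' p ∩ lineThrough θ o = ∅ := by
        rw [Set.eq_empty_iff_forall_notMem]
        rintro z ⟨⟨s, t, -, -, hst, rfl⟩, hz⟩
        apply hpo
        simp only [lineThrough, Set.mem_ofPred_eq, cross_sub, cross_add, cross_smul] at *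
        linear_combination hz - s * hp - cross (dir θ) p * hst
      rw [this, Set.empty_union]
      exact hmono o

/-- Equal barycentric coordinates: a shift of one endpoint along `d` shifts each point of the
segment along `d`. This gives the substitute for a viewpoint on a side that is moved. -/
lemma exists_mem_segment_cross_eq_zero {d p x x' z : Plane} (hx : cross d (x' - x) = 0)
    (hz : z ∈ segment ℝ p x) : ∃ z' ∈ segment ℝ p x', cross d (z' - z) = 0 := by
  obtain ⟨s, t, hs, ht, hst, rfl⟩ := hz
  refine ⟨s • p + t • x', ⟨s, t, hs, ht, hst, rfl⟩, ?_⟩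
  simp only [cross_sub, cross_add, cross_smul] at *
  linear_combination t * hx

lemma mem_segment_split {p q a z : Plane} (ha : a ∈ segment ℝ p q) (hz : z ∈ segment ℝ p q) :
    z ∈ segment ℝ p a ∨ z ∈ segment ℝ a q := by
  rw [segment_eq_image] at ha hz
  obtain ⟨s, hs, rfl⟩ := ha
  obtain ⟨t, ht, rfl⟩ := hz
  simp only
  have e : ∀ r : ℝ, (1 - r) • p + r • q = AffineMap.lineMap p q r := fun r => by
    rw [AffineMap.lineMap_apply_module]
  rw [e, e]
  have key : ∀ r₁ r₂ r : ℝ, r ∈ Set.Icc r₁ r₂ →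
      (AffineMap.lineMap p q r : Plane) ∈
        segment ℝ (AffineMap.lineMap p q r₁ : Plane) (AffineMap.lineMap p q r₂) := by
    intro r₁ r₂ r hr
    rw [← image_segment, segment_eq_Icc (hr.1.trans hr.2)]
    exact ⟨r, hr, rfl⟩
  rcases le_total t s with h | h
  · left; simpa using key 0 s t ⟨ht.1, h⟩
  · right; simpa using key s 1 t ⟨h, ht.2⟩

/-- Replacing a corner `x` of a watchman tour by `a, x', b`, where `a` and `b` lie on the sides at
`x` and `x'` is a translate of `x` in direction `θ`, all within a convex part of the polygon. -/
lemma IsWatchmanTour.exists_slide {P : SimplePolygon n} {θ : ℝ} {T : Fin m → Plane}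
    (hT : IsWatchmanTour P θ T) (hm : 2 ≤ m) (i : Fin m) {B : Set Plane} (hB : Convex ℝ B)
    (hBP : B ⊆ P.region) {a b x' : Plane} (ha : a ∈ segment ℝ (T (i - 1)) (T i))
    (hb : b ∈ segment ℝ (T i) (T (i + 1))) (haB : a ∈ B) (hbB : b ∈ B) (hxB : T i ∈ B)
    (hx'B : x' ∈ B) (hx' : cross (dir θ) (x' - T i) = 0) :
    ∃ S : Fin (m + 2) → Plane, IsWatchmanTour P θ S ∧
      tourLength S + dist a (T i) + dist (T i) b = tourLength T + dist a x' + dist x' b := by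
  obtain ⟨k, rfl⟩ : ∃ k, m = k + 2 := ⟨m - 2, by omega⟩
  set y : ℕ → Plane := fun j => T (i + j • 1) with hy
  have hy0 : y 0 = T i := by simp [hy]
  have hy1 : y 1 = T (i + 1) := by simp [hy]
  have hylast : y (k + 2) = T i := by
    have := card_nsmul_one (m := k + 2)
    simp only [hy, this, add_zero]
  have hypred : y (k + 1) = T (i - 1) := by
    have := card_nsmul_one (m := k + 2)
    rw [succ_nsmul] at this
    simp only [hy, eq_neg_of_add_eq_zero_left this, sub_eq_add_neg]
  have hmemT : ∀ z, z ∈ trace T ↔ ∃ j < k + 2, z ∈ segment ℝ (y j) (y (j + 1)) :=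
    mem_trace_iff_exists_nsmul T i
  -- The new tour is `x', b, T (i + 1), …, T (i - 1), a`, closing with `x'` at index `k + 4 = m +
  -- 2`; old vertices move up by one index.
  set f : ℕ → Plane := fun j => if j = 0 then x' else if j = 1 then b else
    if j = k + 3 then a else if j = k + 4 then x' else y (j - 1) with hfdef
  have f0 : f 0 = x' := by simp [hfdef]
  have f1 : f 1 = b := by simp [hfdef]
  have f3 : f (k + 3) = a := by simp [hfdef]
  have f4 : f (k + 4) = x' := by simp [hfdef]
  have fmid : ∀ j, j < k + 1 → f (j + 2) = y (j + 1) := by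
    intro j hj
    simp only [hfdef]
    rw [if_neg (by omega), if_neg (by omega), if_neg (by omega), if_neg (by omega)]
    rfl
  have hf : f (k + 2 + 2) = f 0 := by rw [f0]; exact f4
  have hmemS := mem_trace_val hf
  refine ⟨fun j => f j, ⟨?_, ?_⟩, ?_⟩
  · intro z hz
    obtain ⟨j, hj, hz⟩ := (hmemS z).1 hz
    rcases Nat.lt_or_ge j 1 with h0 | h0
    · obtain rfl : j = 0 := by omega
      rw [f0, zero_add, f1] at hz
      exact hBP (hB.segment_subset hx'B hbB hz)
    rcases Nat.lt_or_ge j 2 with h1 | h1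
    · obtain rfl : j = 1 := by omega
      refine hT.1 ((hmemT z).2 ⟨0, by omega, ?_⟩)
      rw [f1, fmid 0 (by omega)] at hz
      rw [hy0]
      exact (convex_segment _ _).segment_subset (by rwa [zero_add, hy1])
        (right_mem_segment ℝ _ _) hz
    obtain ⟨l, rfl⟩ : ∃ l, j = l + 2 := ⟨j - 2, by omega⟩
    rcases Nat.lt_or_ge l k with h2 | h2
    · refine hT.1 ((hmemT z).2 ⟨l + 1, by omega, ?_⟩)
      rw [fmid l (by omega), add_right_comm, fmid (l + 1) (by omega)] at hz
      exact hz
    rcases Nat.lt_or_ge l (k + 1) with h3 | h3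
    · obtain rfl : l = k := by omega
      rw [fmid l (by omega), f3] at hz
      refine hT.1 ((hmemT z).2 ⟨l + 1, by omega, ?_⟩)
      rw [hylast]
      rw [hypred] at hz ⊢
      exact (convex_segment _ _).segment_subset (left_mem_segment ℝ _ _) ha hz
    · obtain rfl : l = k + 1 := by omega
      have hz : z ∈ segment ℝ (f (k + 3)) (f (k + 4)) := hz
      rw [f3, f4] at hz
      exact hBP (hB.segment_subset haB hx'B hz)
  · intro q hq
    obtain ⟨p, hp, hpq⟩ := hT.2 q hq
    -- A viewpoint on a removed piece is replaced by its shift along `θ` on the new piece; convexity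
    -- of `B` keeps the segment between the two inside the polygon.
    have hslide : ∀ c c' : Plane, c ∈ B → p ∈ segment ℝ c (T i) →
        (segment ℝ c x' ⊆ trace (fun j : Fin (k + 2 + 2) => f j)) →
        ∃ p' ∈ trace (fun j : Fin (k + 2 + 2) => f j), Sees P θ p' q := by
      intro c _ hc hpc hsub
      obtain ⟨p', hp', hcr⟩ := exists_mem_segment_cross_eq_zero hx' hpc
      refine ⟨p', hsub hp', hpq.of_segment (fun z hz => hBP ?_) hcr⟩
      exact hB.segment_subset (hB.segment_subset hc hx'B hp') (hB.segment_subset hc hxB hpc) hz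
    obtain ⟨j, hj, hpj⟩ := (hmemT p).1 hp
    rcases Nat.lt_or_ge j 1 with h0 | h0
    · obtain rfl : j = 0 := by omega
      rw [hy0, zero_add, hy1] at hpj
      rcases mem_segment_split hb hpj with h | h
      · refine hslide b b hbB (by rwa [segment_symm]) fun z hz => (hmemS z).2 ⟨0, by omega, ?_⟩
        rwa [f0, zero_add, f1, segment_symm]
      · refine ⟨p, (hmemS p).2 ⟨1, by omega, ?_⟩, hpq⟩
        rwa [f1, fmid 0 (by omega), zero_add, hy1]
    obtain ⟨l, rfl⟩ : ∃ l, j = l + 1 := ⟨j - 1, by omega⟩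
    rcases Nat.lt_or_ge l k with h1 | h1
    · refine ⟨p, (hmemS p).2 ⟨l + 2, by omega, ?_⟩, hpq⟩
      rw [fmid l (by omega), add_right_comm, fmid (l + 1) (by omega)]
      exact hpj
    · obtain rfl : l = k := by omega
      rw [hylast, hypred] at hpj
      rcases mem_segment_split ha hpj with h | h
      · refine ⟨p, (hmemS p).2 ⟨l + 2, by omega, ?_⟩, hpq⟩
        rwa [fmid l (by omega), f3, hypred]
      · refine hslide a a haB h fun z hz => (hmemS z).2 ⟨l + 3, by omega, ?_⟩
        rwa [f3, f4]
  · have hS : tourLength (fun j : Fin (k + 2 + 2) => f j) =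
        dist x' b + dist b (T (i + 1)) + (∑ j ∈ Finset.range k, dist (y (j + 1)) (y (j + 2))) +
          dist (T (i - 1)) a + dist a x' := by
      rw [tourLength_val hf, Finset.sum_range_succ, Finset.sum_range_succ, Finset.sum_range_succ',
        Finset.sum_range_succ']
      have e : ∑ j ∈ Finset.range k, dist (f (j + 1 + 1)) (f (j + 1 + 1 + 1)) =
          ∑ j ∈ Finset.range k, dist (y (j + 1)) (y (j + 2)) := by
        refine Finset.sum_congr rfl fun j hj => ?_
        have := Finset.mem_range.1 hj
        rw [show j + 1 + 1 + 1 = (j + 1) + 2 by omega, fmid (j + 1) (by omega),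
          show j + 1 + 1 = j + 2 by omega, fmid j (by omega)]
      rw [e, f0, zero_add, f1, fmid 0 (by omega), fmid k (by omega), f3, f4, hypred, zero_add, hy1]
      ring
    have hTl : tourLength T = dist (T i) (T (i + 1)) +
        (∑ j ∈ Finset.range k, dist (y (j + 1)) (y (j + 2))) + dist (T (i - 1)) (T i) := by
      have h0 : tourLength T = ∑ j ∈ Finset.range (k + 2), dist (y j) (y (j + 1)) :=
        tourLength_eq_sum_range T i
      rw [h0, Finset.sum_range_succ, Finset.sum_range_succ', hy0, hylast, hypred, zero_add, hy1]
      ring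
    have h1 := dist_add_dist_of_mem_segment ha
    have h2 := dist_add_dist_of_mem_segment hb
    rw [hS, hTl]
    linarith

/-! ### The law of reflection at an inner moving vertex -/

/-- The planar scalar product. -/
def dot (u w : Plane) : ℝ := u 0 * w 0 + u 1 * w 1

lemma dot_sub (d u w : Plane) : dot d (u - w) = dot d u - dot d w := by
  simp [dot]; ring

lemma dot_smul (d : Plane) (c : ℝ) (u : Plane) : dot d (c • u) = c * dot d u := by
  simp [dot]; ring

lemma smul_dot (c : ℝ) (d u : Plane) : dot (c • d) u = c * dot d u := by
  simp [dot]; ring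

/-- Lagrange's identity; it recovers lengths from the coordinates along and across a direction that
need not be a unit vector. -/
lemma norm_sq_mul_dot_self (d u : Plane) :
    ‖u‖ ^ 2 * dot d d = dot d u ^ 2 + cross d u ^ 2 := by
  rw [EuclideanSpace.norm_sq_eq, Fin.sum_univ_two]
  simp [dot, cross]; ring

lemma dot_dir_self (θ : ℝ) : dot (dir θ) (dir θ) = 1 := by
  have := Real.cos_sq_add_sin_sq θ
  simp [dot, dir]; linarith

lemma norm_dir (θ : ℝ) : ‖dir θ‖ = 1 := by
  have := Real.cos_sq_add_sin_sq θ
  rw [EuclideanSpace.norm_eq, Fin.sum_univ_two]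
  simp [dir]

lemma cross_self (d : Plane) : cross d d = 0 := by simp [cross]; ring

lemma plane_ext {u w d : Plane} (hd : dot d d ≠ 0) (h0 : dot d u = dot d w)
    (h1 : cross d u = cross d w) : u = w := by
  have h := norm_sq_mul_dot_self d (u - w)
  rw [dot_sub, cross_sub, h0, h1] at h
  simp only [sub_self, ne_eq, OfNat.ofNat_ne_zero, not_false_eq_true, zero_pow, add_zero,
    mul_eq_zero, hd, or_false, pow_eq_zero_iff, norm_eq_zero] at h
  exact sub_eq_zero.1 h

lemma hasDerivAt_dist_add_smul {a x : Plane} (d : Plane) (h : a ≠ x) :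
    HasDerivAt (fun s : ℝ => dist a (x + s • d)) (dot d (x - a) / dist a x) 0 := by
  have hfun : ∀ s : ℝ, dist a (x + s • d) =
      √((a 0 - (x 0 + s * d 0)) ^ 2 + (a 1 - (x 1 + s * d 1)) ^ 2) := fun s => by
    rw [EuclideanSpace.dist_eq, Fin.sum_univ_two]
    simp [Real.dist_eq, sq_abs]
  have h0 : dist a x = √((a 0 - (x 0 + 0 * d 0)) ^ 2 + (a 1 - (x 1 + 0 * d 1)) ^ 2) := by
    rw [← hfun 0]; simp
  have hpos : 0 < dist a x := dist_pos.2 h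
  have hlin : ∀ j : Fin 2, HasDerivAt (fun s : ℝ => a j - (x j + s * d j)) (-(d j)) 0 := fun j => by
    simpa using (((hasDerivAt_id (0 : ℝ)).mul_const (d j)).const_add (x j)).const_sub (a j)
  have hs := ((hlin 0).pow 2).add ((hlin 1).pow 2)
  have hne : (a 0 - (x 0 + 0 * d 0)) ^ 2 + (a 1 - (x 1 + 0 * d 1)) ^ 2 ≠ 0 := by
    intro h'
    rw [h0, h', Real.sqrt_zero] at hpos
    exact lt_irrefl _ hpos
  have hd := hs.sqrt hne
  simp only [Pi.add_apply, Pi.pow_apply] at hd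
  rw [← h0] at hd
  rw [funext hfun]
  refine hd.congr_deriv ?_
  rw [div_eq_div_iff (by positivity) (by positivity)]
  simp only [dot, PiLp.sub_apply]
  push_cast
  ring

/-- A tour cannot be shortened by sliding an inner vertex along the direction of monotonicity. -/
lemma IsShortestWatchmanTour.dot_div_dist_eq {P : SimplePolygon n} {θ : ℝ} {T : Fin m → Plane}
    (hT : IsShortestWatchmanTour P θ T) (hm : 2 ≤ m) (i : Fin m) (hp : T (i - 1) ≠ T i)
    (hq : T i ≠ T (i + 1)) (hint : T i ∈ interior P.region) :
    dot (dir θ) (T i - T (i - 1)) / dist (T (i - 1)) (T i) =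
      dot (dir θ) (T (i + 1) - T i) / dist (T i) (T (i + 1)) := by
  set x := T i
  set p := T (i - 1)
  set q := T (i + 1)
  set d := dir θ
  obtain ⟨r, hr, hball⟩ := Metric.isOpen_iff.1 isOpen_interior x hint
  replace hball := hball.trans interior_subset
  have hA : 0 < dist p x := dist_pos.2 hp
  have hB : 0 < dist x q := dist_pos.2 hq
  -- Small enough for `a` and `b` to lie both on the two sides and in the disc. As both sides shrink
  -- by the same factor, `τ` cancels from the direction cosines.
  set τ : ℝ := min 1 (r / (2 * (dist p x + dist x q))) with hτ
  have hτ0 : 0 < τ := lt_min one_pos (by positivity)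
  have hτ1 : τ ≤ 1 := min_le_left _ _
  have hτr : τ * (2 * (dist p x + dist x q)) ≤ r :=
    (le_div_iff₀ (by positivity)).1 (min_le_right _ _)
  set a := x - τ • (x - p) with ha
  set b := x + τ • (q - x) with hb
  have hxa : x - a = τ • (x - p) := by rw [ha]; abel
  have hbx : b - x = τ • (q - x) := by rw [hb]; abel
  have hda : dist a x = τ * dist p x := by
    rw [dist_comm, dist_eq_norm, hxa, norm_smul, Real.norm_of_nonneg hτ0.le, dist_comm p,
      dist_eq_norm]
  have hdb : dist x b = τ * dist x q := by
    rw [dist_comm, dist_eq_norm, hbx, norm_smul, Real.norm_of_nonneg hτ0.le, dist_comm x,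
      dist_eq_norm]
  have haseg : a ∈ segment ℝ p x := ⟨τ, 1 - τ, hτ0.le, by linarith, by ring, by
    rw [ha, sub_smul, smul_sub, one_smul]; abel⟩
  have hbseg : b ∈ segment ℝ x q := ⟨1 - τ, τ, by linarith, hτ0.le, by ring, by
    rw [hb, sub_smul, smul_sub, one_smul]; abel⟩
  have hax : a ≠ x := by
    rw [← dist_pos, hda]; positivity
  have hbx' : b ≠ x := by
    rw [← dist_pos, dist_comm, hdb]; positivity
  have hmin : IsLocalMin (fun s : ℝ => dist a (x + s • d) + dist b (x + s • d)) 0 := by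
    filter_upwards [Metric.ball_mem_nhds (0 : ℝ) hr] with s hs
    rw [Metric.mem_ball, dist_zero_right] at hs
    obtain ⟨S, hS, hlen⟩ := hT.1.exists_slide hm i (convex_ball x r) hball (x' := x + s • d)
      haseg hbseg
      (by rw [Metric.mem_ball, hda]; nlinarith)
      (by rw [Metric.mem_ball, dist_comm, hdb]; nlinarith)
      (Metric.mem_ball_self hr)
      (by simpa [Metric.mem_ball, dist_eq_norm, norm_smul, d, norm_dir] using hs)
      (by rw [add_sub_cancel_left, cross_smul, cross_self, mul_zero])
    have := hT.2 _ S hS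
    rw [dist_comm b, dist_comm b, zero_smul, add_zero]
    linarith
  have h0 := hmin.hasDerivAt_eq_zero
    ((hasDerivAt_dist_add_smul d hax).add (hasDerivAt_dist_add_smul d hbx'))
  rw [hxa, hda, dist_comm b, hdb, ← neg_sub b x, hbx, ← neg_smul, dot_smul, dot_smul, neg_mul,
    neg_div, mul_div_mul_left _ _ hτ0.ne', mul_div_mul_left _ _ hτ0.ne'] at h0
  linarith

lemma mem_segment_of_smul_eq {p x q : Plane} {α β : ℝ} (hα : 0 < α) (hβ : 0 < β)
    (h : β • (x - p) = α • (q - x)) : x ∈ segment ℝ p q := by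
  refine ⟨β / (α + β), α / (α + β), by positivity, by positivity, by field_simp; ring, ?_⟩
  have hx : (α + β) • x = β • p + α • q := by
    rw [smul_sub, smul_sub, sub_eq_sub_iff_add_eq_add] at h
    rw [add_smul, add_comm, h, add_comm]
  rw [div_eq_inv_mul, div_eq_inv_mul, mul_smul, mul_smul, ← smul_add, ← hx, smul_smul,
    inv_mul_cancel₀ (by positivity), one_smul]

/-- The law of reflection: the two sides at a turn with equal direction cosines lie on the same
side of the line with direction `d` and are mirror images in direction. -/
lemma reflection_of_dot_div_dist_eq {d p x q : Plane} (hd : dot d d = 1) (hp : p ≠ x) (hq : x ≠ q)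
    (hturn : x ∉ segment ℝ p q)
    (h : dot d (x - p) / dist p x = dot d (q - x) / dist x q) :
    cross d (x - p) * cross d (q - x) < 0 ∧
      dot d (x - p) * cross d (q - x) + dot d (q - x) * cross d (x - p) = 0 := by
  have hα : 0 < dist p x := dist_pos.2 hp
  have hβ : 0 < dist x q := dist_pos.2 hq
  have hA := norm_sq_mul_dot_self d (x - p)
  have hB := norm_sq_mul_dot_self d (q - x)
  rw [← dist_eq_norm, dist_comm, hd, mul_one] at hA hB
  set α := dist p x
  set β := dist x q
  rw [div_eq_div_iff hα.ne' hβ.ne'] at h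
  set u := dot d (x - p) with hu
  set v := dot d (q - x) with hv
  set a := cross d (x - p) with ha
  set b := cross d (q - x) with hb
  -- Equal direction cosines force equal squared sines. Equal sines would mean no turn at `x`, so
  -- the sines are opposite.
  have hsq : (a * β - b * α) * (a * β + b * α) = 0 := by
    linear_combination (-β ^ 2) * hA + α ^ 2 * hB - (u * β + v * α) * h
  have hne : a * β - b * α ≠ 0 := by
    intro h0
    refine hturn (mem_segment_of_smul_eq hα hβ (plane_ext (d := d) (by rw [hd]; exact one_ne_zero)
      ?_ ?_))
    · rw [dot_smul, dot_smul, ← hu, ← hv]; linarith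
    · rw [cross_smul, cross_smul, ← ha, ← hb]; linarith
  have hsum : a * β + b * α = 0 := (mul_eq_zero.1 hsq).resolve_left hne
  have hb0 : b ≠ 0 := by
    intro h0
    rw [h0] at hsum hne
    exact hne (by linarith)
  constructor
  · have h1 : a * b * β = -(b ^ 2 * α) := by linear_combination b * hsum
    have h2 : 0 < b ^ 2 * α := by positivity
    by_contra hcon
    have := mul_nonneg (not_lt.1 hcon) hβ.le
    linarith
  · have h1 : (u * b + v * a) * (α * β) = 0 := by
      linear_combination b * α * h + v * α * hsum
    exact (mul_eq_zero.1 h1).resolve_right (by positivity)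

/-! ### Configurations that obey an itinerary -/

/-- Vertex `i` of the tour `x` obeys the stop `s` for the direction of `d`: a stable vertex is
fixed, the tour is reflected at the gate of an inner moving vertex, and a far end is the
intersection of the gate and the gate edge. -/
def Obeys (d : Plane) (x : Fin m → Plane) (i : Fin m) : Stop → Prop
  | Stop.point => False
  | Stop.stable w => x i = w
  | Stop.inner v => cross d (x i) = cross d v ∧
      cross d (x i - x (i - 1)) * cross d (x (i + 1) - x i) < 0 ∧
      dot d (x i - x (i - 1)) * cross d (x (i + 1) - x i) +
        dot d (x (i + 1) - x i) * cross d (x i - x (i - 1)) = 0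
  | Stop.farEnd v a b => cross d (b - a) ≠ 0 ∧ cross d (x i) = cross d v ∧
      cross (b - a) (x i - a) = 0

/-- The conditions are homogeneous in `d`, and the inequality is quadratic, so even a negative
factor is harmless. This allows the cosine of `ε` to be divided out. -/
lemma Obeys.of_smul {c : ℝ} (hc : c ≠ 0) {d : Plane} {x : Fin m → Plane} {i : Fin m} {s : Stop}
    (h : Obeys (c • d) x i s) : Obeys d x i s := by
  cases s with
  | point => exact h
  | stable w => exact h
  | inner v =>
    obtain ⟨h1, h2, h3⟩ := h
    simp only [smul_cross, smul_dot] at h1 h2 h3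
    refine ⟨mul_left_cancel₀ hc h1, ?_, ?_⟩
    · have hc2 : 0 < c ^ 2 := by positivity
      by_contra hcon
      have := mul_nonneg hc2.le (not_lt.1 hcon)
      linarith
    · refine (mul_eq_zero.1 (?_ : c ^ 2 * _ = 0)).resolve_left (pow_ne_zero 2 hc)
      linear_combination h3
  | farEnd v a b =>
    obtain ⟨h1, h2, h3⟩ := h
    simp only [smul_cross] at h1 h2
    exact ⟨right_ne_zero_of_mul h1, mul_left_cancel₀ hc h2, h3⟩

lemma cutSet_subset_lineThrough (P : SimplePolygon n) (θ : ℝ) (c : CutName n) :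
    cutSet P θ c ⊆ lineThrough θ (P.vertex c.1) := fun _ hx =>
  (connectedComponentIn_subset _ _ hx.1).2

lemma cross_eq_of_mem_cutSet {P : SimplePolygon n} {θ : ℝ} {c : CutName n} {x : Plane}
    (hx : x ∈ cutSet P θ c) : cross (dir θ) x = cross (dir θ) (P.vertex c.1) := by
  have h : cross (dir θ) (x - P.vertex c.1) = 0 := cutSet_subset_lineThrough P θ c hx
  rwa [cross_sub, sub_eq_zero] at h

lemma IsFarEnd.mem_cutSet {P : SimplePolygon n} {θ : ℝ} {c : CutName n} {E : Plane}
    (h : IsFarEnd P θ c E) : E ∈ cutSet P θ c := by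
  rw [h.2]; exact right_mem_segment ℝ _ _

lemma IsFarEnd.unique {P : SimplePolygon n} {θ : ℝ} {c : CutName n} {E E' : Plane}
    (h : IsFarEnd P θ c E) (h' : IsFarEnd P θ c E') : E = E' := by
  have h1 := dist_add_dist_of_mem_segment (h'.2 ▸ h.mem_cutSet)
  have h2 := dist_add_dist_of_mem_segment (h.2 ▸ h'.mem_cutSet)
  rw [dist_comm E' E] at h2
  exact dist_eq_zero.1 (by linarith)

lemma cross_sub_eq_zero_of_mem_segment {a b x : Plane} (h : x ∈ segment ℝ a b) :
    cross (b - a) (x - a) = 0 := by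
  obtain ⟨s, t, -, -, hst, rfl⟩ := h
  have : s • a + t • b - a = t • (b - a) := by
    rw [← eq_sub_iff_add_eq] at hst
    rw [hst, sub_smul, smul_sub, one_smul]; abel
  rw [this, cross_smul, cross_self, mul_zero]

/-- Minimality enters only here, at inner stops; the rest of the length computation is algebra on
the itinerary. -/
lemma IsShortestWatchmanTour.obeys {P : SimplePolygon n} {θ : ℝ} {T : Fin m → Plane}
    (hT : IsShortestWatchmanTour P θ T) (hm : 2 ≤ m) (hne : ∀ i, T i ≠ T (i + 1)) {i : Fin m}
    {c : CutName n} {s : Stop} (h : DescribesVertex P θ T i c s) : Obeys (dir θ) T i s := by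
  cases s with
  | point =>
    have : m = 1 := h
    omega
  | stable w => exact h.1
  | inner v =>
    obtain ⟨hv, -, hcut, hint, hturn⟩ := h
    have hp : T (i - 1) ≠ T i := by simpa using hne (i - 1)
    refine ⟨by rw [cross_eq_of_mem_cutSet hcut, hv], ?_⟩
    exact reflection_of_dot_div_dist_eq (dot_dir_self θ) hp (hne i) hturn
      (hT.dot_div_dist_eq hm i hp (hne i) hint)
  | farEnd v a b =>
    obtain ⟨hv, -, hfar, e, ⟨⟨E, hE, hEfar⟩, hpar⟩, rfl, rfl⟩ := h
    refine ⟨hpar, by rw [cross_eq_of_mem_cutSet hfar.mem_cutSet, hv], ?_⟩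
    rw [hfar.unique hEfar]
    exact cross_sub_eq_zero_of_mem_segment hE

/-- The direction `θ + ε`, scaled so as to be linear in `t = tan ε`. -/
def tilt (θ t : ℝ) : Plane := !₂[Real.cos θ - t * Real.sin θ, Real.sin θ + t * Real.cos θ]

lemma dir_add_eq_smul_tilt (θ : ℝ) {ε : ℝ} (hε : Real.cos ε ≠ 0) :
    dir (θ + ε) = Real.cos ε • tilt θ (Real.tan ε) := by
  ext j
  fin_cases j <;> simp [dir, tilt, Real.cos_add, Real.sin_add, Real.tan_eq_sin_div_cos] <;>
    field_simp

lemma tilt_zero (θ : ℝ) : tilt θ 0 = dir θ := by simp [tilt, dir]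

lemma dot_tilt_self (θ t : ℝ) : dot (tilt θ t) (tilt θ t) = 1 + t ^ 2 := by
  have := Real.cos_sq_add_sin_sq θ
  simp [dot, tilt]
  linear_combination (1 + t ^ 2) * this

open Polynomial

/-! ### Square roots of rational functions -/

/-- On the set `C` of pairs `(t, x)`, the function `f` of `x` is the square root of a rational
function of `t` with numerator and denominator of degree at most `D`. -/
def IsRootFun {X : Type*} (C : ℝ → X → Prop) (D : ℕ) (f : X → ℝ) : Prop :=
  ∃ N Q : ℝ[X], N.natDegree ≤ D ∧ Q.natDegree ≤ D ∧
    ∀ t x, C t x → Q.eval t ≠ 0 ∧ 0 ≤ f x ∧ f x ^ 2 * Q.eval t = N.eval t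

lemma IsRootFun.zero {X : Type*} (C : ℝ → X → Prop) (D : ℕ) : IsRootFun C D (fun _ => 0) :=
  ⟨0, 1, by simp, by simp, fun t x _ => by simp⟩

lemma eval_eq_coeff_zero_add_sum {N : ℝ[X]} {D : ℕ} (h : N.natDegree ≤ D) (t : ℝ) :
    N.eval t = N.coeff 0 + ∑ i ∈ Finset.Icc 1 D, N.coeff i * t ^ i := by
  rw [eval_eq_sum_range' (Nat.lt_succ_of_le h), Finset.range_eq_Ico,
    Finset.sum_eq_sum_Ico_succ_bot (Nat.succ_pos D)]
  simp only [pow_zero, mul_one, zero_add]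
  rfl

/-- Dividing numerator and denominator by `q`, the constant term of `Q`, gives the normal form with
denominator `1 + ⋯`. -/
lemma rootTerm_of_eval_eq {N Q : ℝ[X]} {a : ℕ → ℝ} {o D : ℕ} {q t y : ℝ}
    (hN : N.natDegree ≤ D) (hQ : Q.natDegree ≤ D) (hq : q ≠ 0) (hQ0 : Q.coeff 0 = q)
    (ha0 : a o ^ 2 = N.coeff 0 / q)
    (haN : ∀ i ∈ Finset.Icc 1 D, a (o + i) = N.coeff i / q)
    (haQ : ∀ i ∈ Finset.Icc 1 D, a (o + D + i) = Q.coeff i / q)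
    (hQt : Q.eval t ≠ 0) (hy : 0 ≤ y) (hyt : y ^ 2 * Q.eval t = N.eval t) :
    RootTermDefined a o D t ∧ rootTerm a o D t = y - a o := by
  have h1 : numer a o D t = N.eval t / q := by
    rw [numer, eval_eq_coeff_zero_add_sum hN, add_div, Finset.sum_div, ha0]
    congr 1
    exact Finset.sum_congr rfl fun i hi => by rw [haN i hi]; ring
  have h2 : denom a o D t = Q.eval t / q := by
    rw [denom, eval_eq_coeff_zero_add_sum hQ, add_div, Finset.sum_div, hQ0, div_self hq]
    congr 1
    exact Finset.sum_congr rfl fun i hi => by rw [haQ i hi]; ring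
  have h3 : numer a o D t / denom a o D t = y ^ 2 := by
    rw [h1, h2, div_div_div_cancel_right₀ hq, ← hyt, mul_div_cancel_right₀ _ hQt]
  refine ⟨⟨?_, ?_⟩, ?_⟩
  · rw [h2]; exact div_ne_zero hQt hq
  · rw [h3]; positivity
  · rw [rootTerm, h3, Real.sqrt_sq hy]

/-- The constants of one gate, for a function that is a sum of a root of degree `4` and a root of
degree `14`. -/
lemma exists_gateTerm_eq {X : Type*} {C : ℝ → X → Prop} {x₀ : X} (h₀ : C 0 x₀) {g h : X → ℝ}
    (hg : IsRootFun C 14 g) (hh : IsRootFun C 4 h) :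
    ∃ a : ℕ → ℝ, ∀ ε x, C (Real.tan ε) x →
      GateTermDefined a ε ∧ gateTerm a ε = (h x - h x₀) + (g x - g x₀) := by
  obtain ⟨N, Q, hN, hQ, hC⟩ := hh
  obtain ⟨N', Q', hN', hQ', hC'⟩ := hg
  obtain ⟨hq, -, hv⟩ := hC 0 x₀ h₀
  obtain ⟨hq', -, hv'⟩ := hC' 0 x₀ h₀
  rw [← coeff_zero_eq_eval_zero] at hq hv hq' hv'
  rw [← coeff_zero_eq_eval_zero] at hv hv'
  -- The first two roots are not needed, and zero constants make them vanish. The blocks from 10 and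
  -- from 19 hold the value at `x₀` followed by the normalised coefficients.
  let a : ℕ → ℝ := fun j =>
    if j < 10 then 0 else if j = 10 then h x₀ else if j ≤ 14 then N.coeff (j - 10) / Q.coeff 0
    else if j ≤ 18 then Q.coeff (j - 14) / Q.coeff 0 else if j = 19 then g x₀
    else if j ≤ 33 then N'.coeff (j - 19) / Q'.coeff 0 else Q'.coeff (j - 33) / Q'.coeff 0
  have a10 : a 10 = h x₀ := rfl
  have a19 : a 19 = g x₀ := rfl
  have aN : ∀ i ∈ Finset.Icc 1 4, a (10 + i) = N.coeff i / Q.coeff 0 := by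
    intro i hi; rw [Finset.mem_Icc] at hi
    simp only [a]
    rw [if_neg (by omega), if_neg (by omega), if_pos (by omega), Nat.add_sub_cancel_left]
  have aQ : ∀ i ∈ Finset.Icc 1 4, a (10 + 4 + i) = Q.coeff i / Q.coeff 0 := by
    intro i hi; rw [Finset.mem_Icc] at hi
    simp only [a]
    rw [if_neg (by omega), if_neg (by omega), if_neg (by omega), if_pos (by omega),
      Nat.add_sub_cancel_left]
  have aN' : ∀ i ∈ Finset.Icc 1 14, a (19 + i) = N'.coeff i / Q'.coeff 0 := by
    intro i hi; rw [Finset.mem_Icc] at hi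
    simp only [a]
    rw [if_neg (by omega), if_neg (by omega), if_neg (by omega), if_neg (by omega),
      if_neg (by omega), if_pos (by omega), Nat.add_sub_cancel_left]
  have aQ' : ∀ i ∈ Finset.Icc 1 14, a (19 + 14 + i) = Q'.coeff i / Q'.coeff 0 := by
    intro i hi; rw [Finset.mem_Icc] at hi
    simp only [a]
    rw [if_neg (by omega), if_neg (by omega), if_neg (by omega), if_neg (by omega),
      if_neg (by omega), if_neg (by omega), Nat.add_sub_cancel_left]
  have a0 : ∀ j < 10, a j = 0 := fun j hj => if_pos hj
  have hzero : ∀ o t, o ≤ 5 → RootTermDefined a o 2 t ∧ rootTerm a o 2 t = 0 := by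
    intro o t ho
    have := rootTerm_of_eval_eq (N := 0) (Q := 1) (a := a) (o := o) (D := 2) (q := 1) (t := t)
      (y := 0) (by simp) (by simp) one_ne_zero (by simp) (by simp [a0 o (by omega)])
      (fun i hi => by rw [Finset.mem_Icc] at hi; simp [a0 (o + i) (by omega)])
      (fun i hi => by
        rw [Finset.mem_Icc] at hi
        rw [a0 (o + 2 + i) (by omega), coeff_one, if_neg (by omega), zero_div])
      (by simp) le_rfl (by simp)
    rwa [a0 o (by omega), sub_zero] at this
  refine ⟨a, fun ε x hx => ?_⟩
  obtain ⟨c1, c2, c3⟩ := hC _ x hx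
  obtain ⟨c1', c2', c3'⟩ := hC' _ x hx
  have h4 := rootTerm_of_eval_eq hN hQ hq rfl
    (by rw [a10, eq_div_iff hq, hv]) aN aQ c1 c2 c3
  have h14 := rootTerm_of_eval_eq hN' hQ' hq' rfl
    (by rw [a19, eq_div_iff hq', hv']) aN' aQ' c1' c2' c3'
  refine ⟨⟨(hzero 0 _ (by omega)).1, (hzero 5 _ (by omega)).1, h4.1, h14.1⟩, ?_⟩
  rw [gateTerm, (hzero 0 _ (by omega)).2, (hzero 5 _ (by omega)).2, h4.2, h14.2, a10, a19]
  ring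

lemma gateTerm_zero (ε : ℝ) : GateTermDefined (fun _ => 0) ε ∧ gateTerm (fun _ => 0) ε = 0 := by
  simp [GateTermDefined, RootTermDefined, gateTerm, rootTerm, numer, denom]

/-! ### Coordinates along and across the direction, as functions of the tangent -/

/-- `cross (tilt θ t) z` as a polynomial in `t`. -/
def crossPoly (θ : ℝ) (z : Plane) : ℝ[X] := C (cross (dir θ) z) - C (dot (dir θ) z) * X

/-- `dot (tilt θ t) z` as a polynomial in `t`. -/
def dotPoly (θ : ℝ) (z : Plane) : ℝ[X] := C (dot (dir θ) z) + C (cross (dir θ) z) * X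

lemma eval_crossPoly (θ t : ℝ) (z : Plane) : (crossPoly θ z).eval t = cross (tilt θ t) z := by
  simp [crossPoly, cross, dot, tilt, dir]; ring

lemma eval_dotPoly (θ t : ℝ) (z : Plane) : (dotPoly θ z).eval t = dot (tilt θ t) z := by
  simp [dotPoly, cross, dot, tilt, dir]; ring

lemma natDegree_crossPoly_le (θ : ℝ) (z : Plane) : (crossPoly θ z).natDegree ≤ 1 := by
  rw [crossPoly]; compute_degree

lemma natDegree_dotPoly_le (θ : ℝ) (z : Plane) : (dotPoly θ z).natDegree ≤ 1 := by
  rw [dotPoly]; compute_degree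

lemma natDegree_one_add_X_sq_le : (1 + X ^ 2 : ℝ[X]).natDegree ≤ 2 := by compute_degree

/-- All vertices of the tour `x` obey the itinerary `R` for the direction `θ` tilted by `t`. -/
def Follows (R : Fin m → Stop) (θ t : ℝ) (x : Fin m → Plane) : Prop :=
  ∀ i, Obeys (tilt θ t) x i (R i)

def Stop.IsInner : Stop → Prop
  | Stop.inner _ => True
  | _ => False

/-- A vertex at this stop lies on the line with the given direction through this point. -/
def Stop.base : Stop → Plane
  | Stop.point => 0
  | Stop.stable w => w
  | Stop.inner v => v
  | Stop.farEnd v _ _ => v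

lemma Obeys.cross_eq {d : Plane} {x : Fin m → Plane} {i : Fin m} {s : Stop} (h : Obeys d x i s) :
    cross d (x i) = cross d s.base := by
  cases s with
  | point => exact h.elim
  | stable w => rw [show x i = w from h]; rfl
  | inner v => exact h.1
  | farEnd v a b => exact h.2.1

/-- The difference of the coordinates across the direction along the side `i` of the tour. -/
def sidePoly (R : Fin m → Stop) (θ : ℝ) (i : Fin m) : ℝ[X] :=
  crossPoly θ ((R (i + 1)).base - (R i).base)

lemma Follows.eval_sidePoly {R : Fin m → Stop} {θ t : ℝ} {x : Fin m → Plane}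
    (h : Follows R θ t x) (i : Fin m) :
    (sidePoly R θ i).eval t = cross (tilt θ t) (x (i + 1) - x i) := by
  rw [sidePoly, eval_crossPoly, cross_sub, cross_sub, (h i).cross_eq, (h (i + 1)).cross_eq]

lemma natDegree_sidePoly_le (R : Fin m → Stop) (θ : ℝ) (i : Fin m) :
    (sidePoly R θ i).natDegree ≤ 1 := natDegree_crossPoly_le _ _

/-- The coordinate along the direction of a far end is a rational function of the tangent. -/
lemma Obeys.exists_dot_mul_eq (s : Stop) (hs : ¬ s.IsInner) (θ : ℝ) :
    ∃ N D : ℝ[X], N.natDegree ≤ 2 ∧ D.natDegree ≤ 1 ∧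
      ∀ (t : ℝ) (x : Fin m → Plane) (i : Fin m), Obeys (tilt θ t) x i s →
        D.eval t ≠ 0 ∧ dot (tilt θ t) (x i) * D.eval t = N.eval t := by
  cases s with
  | point => exact ⟨0, 0, by simp, by simp, fun t x i h => h.elim⟩
  | stable w =>
    refine ⟨dotPoly θ w, 1, (natDegree_dotPoly_le _ _).trans (by norm_num), by simp, ?_⟩
    intro t x i h
    rw [show x i = w from h, eval_dotPoly]
    simp
  | inner v => exact (hs trivial).elim
  | farEnd v a b =>
    refine ⟨dotPoly θ a * crossPoly θ (b - a) + crossPoly θ (v - a) * dotPoly θ (b - a),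
      crossPoly θ (b - a), ?_, natDegree_crossPoly_le _ _, ?_⟩
    · exact natDegree_add_le_of_degree_le
        (natDegree_mul_le_of_le (natDegree_dotPoly_le _ _) (natDegree_crossPoly_le _ _))
        (natDegree_mul_le_of_le (natDegree_crossPoly_le _ _) (natDegree_dotPoly_le _ _))
    · rintro t x i ⟨h1, h2, h3⟩
      rw [eval_add, eval_mul, eval_mul]
      simp only [eval_dotPoly, eval_crossPoly]
      refine ⟨h1, ?_⟩
      -- For `p = x i - a` and `q = b - a` the right side vanishes, as `x i` lies on the line of the
      -- gate edge; what remains is Cramer's rule.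
      have key : ∀ e p q : Plane, dot e p * cross e q - cross e p * dot e q =
          - (dot e e * cross q p) := by
        intro e p q; simp [dot, cross]; ring
      have hk := key (tilt θ t) (x i - a) (b - a)
      rw [h3, mul_zero, neg_zero] at hk
      rw [dot_sub _ (x i), cross_sub _ (x i), h2, ← cross_sub _ v] at hk
      linear_combination hk

lemma dist_sq_mul_eq (θ t : ℝ) (p q : Plane) :
    dist p q ^ 2 * (1 + t ^ 2) = dot (tilt θ t) (q - p) ^ 2 + cross (tilt θ t) (q - p) ^ 2 := by
  rw [← norm_sq_mul_dot_self, dot_tilt_self, dist_comm, dist_eq_norm]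

/-- The difference of the coordinates along the direction between two vertices, as a fraction. -/
lemma Follows.exists_dot_sub_mul_eq (R : Fin m → Stop) (θ : ℝ) {i j : Fin m}
    (hi : ¬ (R i).IsInner) (hj : ¬ (R j).IsInner) :
    ∃ N D : ℝ[X], N.natDegree ≤ 3 ∧ D.natDegree ≤ 2 ∧ ∀ t x, Follows R θ t x →
      D.eval t ≠ 0 ∧ dot (tilt θ t) (x j - x i) * D.eval t = N.eval t := by
  obtain ⟨N, D, hN, hD, h⟩ := Obeys.exists_dot_mul_eq (m := m) (R i) hi θ
  obtain ⟨N', D', hN', hD', h'⟩ := Obeys.exists_dot_mul_eq (m := m) (R j) hj θ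
  refine ⟨N' * D - N * D', D * D', ?_, natDegree_mul_le_of_le hD hD', fun t x hx => ?_⟩
  · exact natDegree_sub_le_of_le (natDegree_mul_le_of_le hN' hD) (natDegree_mul_le_of_le hN hD')
      |>.trans (by norm_num)
  · obtain ⟨h1, h2⟩ := h t x i (hx i)
    obtain ⟨h1', h2'⟩ := h' t x j (hx j)
    rw [eval_sub, eval_mul, eval_mul, eval_mul, dot_sub]
    exact ⟨mul_ne_zero h1 h1', by linear_combination D.eval t * h2' - D'.eval t * h2⟩

/-- As `Follows.exists_dot_sub_mul_eq`, from a stable vertex. -/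
lemma Follows.exists_dot_sub_mul_eq_of_stable (R : Fin m → Stop) (θ : ℝ) {i j : Fin m} {w : Plane}
    (hi : R i = Stop.stable w) (hj : ¬ (R j).IsInner) :
    ∃ N D : ℝ[X], N.natDegree ≤ 2 ∧ D.natDegree ≤ 1 ∧ ∀ t x, Follows R θ t x →
      D.eval t ≠ 0 ∧ dot (tilt θ t) (x j - x i) * D.eval t = N.eval t := by
  obtain ⟨N, D, hN, hD, h⟩ := Obeys.exists_dot_mul_eq (m := m) (R j) hj θ
  refine ⟨N - dotPoly θ w * D, D, ?_, hD, fun t x hx => ?_⟩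
  · exact natDegree_sub_le_of_le hN (natDegree_mul_le_of_le (natDegree_dotPoly_le _ _) hD)
      |>.trans (by norm_num)
  · obtain ⟨h1, h2⟩ := h t x j (hx j)
    have hw := hx i
    rw [hi] at hw
    rw [eval_sub, eval_mul, eval_dotPoly, dot_sub, show x i = w from hw]
    exact ⟨h1, by linear_combination h2⟩

/-- Pythagoras in the tilted frame, whose squared scale is `1 + t ^ 2`. The case `r = 1`, a side
from a stable vertex, yields exactly the degree 4 of the third root. -/
lemma isRootFun_dist_of_dot {R : Fin m → Stop} {θ : ℝ} {i : Fin m} {r D : ℕ} {N Q : ℝ[X]}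
    (hN : N.natDegree ≤ r + 1) (hQ : Q.natDegree ≤ r) (hD : 2 * (r + 1) ≤ D)
    (h : ∀ t x, Follows R θ t x →
      Q.eval t ≠ 0 ∧ dot (tilt θ t) (x (i + 1) - x i) * Q.eval t = N.eval t) :
    IsRootFun (Follows R θ) D (fun x => dist (x i) (x (i + 1))) := by
  refine ⟨N ^ 2 + sidePoly R θ i ^ 2 * Q ^ 2, (1 + X ^ 2) * Q ^ 2, ?_, ?_, fun t x hx => ?_⟩
  · refine (natDegree_add_le_of_degree_le (n := 2 * (r + 1)) (natDegree_pow_le_of_le 2 hN) ?_).trans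
      hD
    refine (natDegree_mul_le_of_le (natDegree_pow_le_of_le 2 (natDegree_sidePoly_le R θ i))
      (natDegree_pow_le_of_le 2 hQ)).trans (by omega)
  · exact (natDegree_mul_le_of_le natDegree_one_add_X_sq_le
      (natDegree_pow_le_of_le 2 hQ)).trans (by omega)
  · obtain ⟨h1, h2⟩ := h t x hx
    have hd := dist_sq_mul_eq θ t (x i) (x (i + 1))
    simp only [eval_add, eval_mul, eval_pow, eval_one, eval_X, hx.eval_sidePoly]
    refine ⟨by positivity, dist_nonneg, ?_⟩
    rw [← h2]
    linear_combination Q.eval t ^ 2 * hd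

/-! ### The slope of the sides next to inner vertices -/

/-- The slope of side `i` of the tour with respect to the direction is a rational function. -/
def HasSlope (R : Fin m → Stop) (θ : ℝ) (i : Fin m) : Prop :=
  ∃ K Q : ℝ[X], K.natDegree ≤ 6 ∧ Q.natDegree ≤ 8 ∧ ∀ t x, Follows R θ t x →
    Q.eval t ≠ 0 ∧
      dist (x i) (x (i + 1)) ^ 2 * Q.eval t = cross (tilt θ t) (x (i + 1) - x i) ^ 2 * K.eval t

lemma HasSlope.isRootFun_dist {R : Fin m → Stop} {θ : ℝ} {i : Fin m} (h : HasSlope R θ i) :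
    IsRootFun (Follows R θ) 14 (fun x => dist (x i) (x (i + 1))) := by
  obtain ⟨K, Q, hK, hQ, h⟩ := h
  refine ⟨sidePoly R θ i ^ 2 * K, Q, ?_, hQ.trans (by norm_num), fun t x hx => ?_⟩
  · exact (natDegree_mul_le_of_le (natDegree_pow_le_of_le 2 (natDegree_sidePoly_le R θ i))
      hK).trans (by norm_num)
  · rw [eval_mul, eval_pow, hx.eval_sidePoly]
    exact ⟨(h t x hx).1, dist_nonneg, (h t x hx).2⟩

/-- The lengths of the sides at an inner vertex are proportional to their extents across the
direction. -/
lemma Follows.dist_mul_cross_eq {R : Fin m → Stop} {θ t : ℝ} {x : Fin m → Plane}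
    (hx : Follows R θ t x) {i : Fin m} (hi : (R i).IsInner) :
    cross (tilt θ t) (x (i + 1) - x i) ≠ 0 ∧
    dist (x (i - 1)) (x i) * cross (tilt θ t) (x (i + 1) - x i) =
      -(dist (x i) (x (i + 1)) * cross (tilt θ t) (x i - x (i - 1))) := by
  have h := hx i
  generalize R i = s at h hi
  cases s with
  | point => exact h.elim
  | stable w => exact hi.elim
  | farEnd v a b => exact hi.elim
  | inner v =>
    obtain ⟨-, hneg, hrefl⟩ := h
    have hA := dist_sq_mul_eq θ t (x (i - 1)) (x i)
    have hB := dist_sq_mul_eq θ t (x i) (x (i + 1))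
    have hα : 0 ≤ dist (x (i - 1)) (x i) := dist_nonneg
    have hβ : 0 ≤ dist (x i) (x (i + 1)) := dist_nonneg
    generalize dist (x (i - 1)) (x i) = α at *
    generalize dist (x i) (x (i + 1)) = β at *
    generalize cross (tilt θ t) (x (i + 1) - x i) = b at *
    generalize cross (tilt θ t) (x i - x (i - 1)) = a at *
    generalize dot (tilt θ t) (x (i + 1) - x i) = v' at *
    generalize dot (tilt θ t) (x i - x (i - 1)) = u at *
    have hb : b ≠ 0 := right_ne_zero_of_mul hneg.ne
    refine ⟨hb, ?_⟩
    -- Reflection gives this up to sign. Since `a` and `b` have opposite signs, the wrong sign is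
    -- possible only if `α = 0`.
    have hsq : (α * b) ^ 2 = (-(β * a)) ^ 2 := by
      refine mul_right_cancel₀ (show (1 + t ^ 2 : ℝ) ≠ 0 by positivity) ?_
      linear_combination b ^ 2 * hA - a ^ 2 * hB + (u * b - v' * a) * hrefl
    rcases sq_eq_sq_iff_eq_or_eq_neg.1 hsq with h | h
    · exact h
    · have h1 : α * b ^ 2 = β * (a * b) := by linear_combination b * h
      have h2 : β * (a * b) ≤ 0 := mul_nonpos_of_nonneg_of_nonpos hβ hneg.le
      have hb2 : 0 < b ^ 2 := by positivity
      have h3 : α = 0 := by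
        by_contra hne
        have := mul_pos (lt_of_le_of_ne hα (Ne.symm hne)) hb2
        linarith
      rw [h3, zero_mul] at h ⊢
      linarith

/-- Unfolding at the reflection turns the two sides into one straight segment, whose extent across
the direction is the difference of the signed extents. So a single root covers both. -/
lemma HasSlope.isRootFun_dist_add_dist {R : Fin m → Stop} {θ : ℝ} {i : Fin m}
    (hi : (R i).IsInner) (h : HasSlope R θ i) :
    IsRootFun (Follows R θ) 14 (fun x => dist (x i) (x (i + 1)) + dist (x (i - 1)) (x i)) := by
  obtain ⟨K, Q, hK, hQ, h⟩ := h
  refine ⟨(sidePoly R θ i - sidePoly R θ (i - 1)) ^ 2 * K, Q, ?_, hQ.trans (by norm_num),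
    fun t x hx => ⟨(h t x hx).1, by positivity, ?_⟩⟩
  · exact (natDegree_mul_le_of_le (natDegree_pow_le_of_le 2 (natDegree_sub_le_of_le
      (natDegree_sidePoly_le R θ i) (natDegree_sidePoly_le R θ (i - 1)))) hK).trans (by norm_num)
  · obtain ⟨hb, hr⟩ := hx.dist_mul_cross_eq hi
    rw [eval_mul, eval_pow, eval_sub, hx.eval_sidePoly, hx.eval_sidePoly, sub_add_cancel]
    refine mul_right_cancel₀ (pow_ne_zero 2 hb) ?_
    have h2 := (h t x hx).2
    beta_reduce
    generalize cross (tilt θ t) (x (i + 1) - x i) = b at *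
    generalize cross (tilt θ t) (x i - x (i - 1)) = a at *
    generalize dist (x (i - 1)) (x i) = α at *
    generalize dist (x i) (x (i + 1)) = β at *
    have hsum : (β + α) * b = β * (b - a) := by linear_combination hr
    calc (β + α) ^ 2 * Q.eval t * b ^ 2 = ((β + α) * b) ^ 2 * Q.eval t := by ring
      _ = (b - a) ^ 2 * (β ^ 2 * Q.eval t) := by rw [hsum]; ring
      _ = (b - a) ^ 2 * K.eval t * b ^ 2 := by rw [h2]; ring

lemma HasSlope.of_inner {R : Fin m → Stop} {θ : ℝ} {i : Fin m}
    (hi : (R (i + 1)).IsInner) (h : HasSlope R θ (i + 1)) : HasSlope R θ i := by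
  obtain ⟨K, Q, hK, hQ, h⟩ := h
  refine ⟨K, Q, hK, hQ, fun t x hx => ⟨(h t x hx).1, ?_⟩⟩
  obtain ⟨hb, hr⟩ := hx.dist_mul_cross_eq hi
  have h2 := (h t x hx).2
  rw [add_sub_cancel_right] at hr
  refine mul_right_cancel₀ (pow_ne_zero 2 hb) ?_
  generalize cross (tilt θ t) (x (i + 1 + 1) - x (i + 1)) = b at *
  generalize cross (tilt θ t) (x (i + 1) - x i) = a at *
  generalize dist (x i) (x (i + 1)) = α at *
  generalize dist (x (i + 1)) (x (i + 1 + 1)) = β at *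
  calc α ^ 2 * Q.eval t * b ^ 2 = (α * b) ^ 2 * Q.eval t := by ring
    _ = a ^ 2 * (β ^ 2 * Q.eval t) := by rw [hr]; ring
    _ = a ^ 2 * K.eval t * b ^ 2 := by rw [h2]; ring

/-- In a sequence of consecutive reflections, the slope is that of the unfolded path. -/
lemma alternating_slope {c u : ℕ → ℝ} {k : ℕ} (hk : 2 ≤ k)
    (h : ∀ l, l + 1 < k → c l * c (l + 1) < 0 ∧ u l * c (l + 1) + u (l + 1) * c l = 0) :
    (∑ l ∈ Finset.range k, (-1) ^ l * c l) ≠ 0 ∧ ∀ l < k,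
      u l * (∑ l ∈ Finset.range k, (-1) ^ l * c l) =
        (-1) ^ l * c l * ∑ l ∈ Finset.range k, u l := by
  have hc0 : c 0 ≠ 0 := left_ne_zero_of_mul (h 0 (by omega)).1.ne
  -- The `c l` alternate in sign, so the alternating sum has no cancellation and cannot vanish.
  have hpos : ∀ l < k, 0 < (-1) ^ l * c l * c 0 := by
    intro l
    induction l with
    | zero => intro _; rw [pow_zero, one_mul]; exact mul_self_pos.2 hc0
    | succ l ih =>
      intro hl
      have h1 := ih (by omega)
      have h2 := (h l hl).1
      have h3 : 0 < ((-1) ^ l * c l * c 0) * -(c l * c (l + 1)) := mul_pos h1 (by linarith)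
      have h4 : ((-1) ^ l * c l * c 0) * -(c l * c (l + 1)) =
          c l ^ 2 * ((-1) ^ (l + 1) * c (l + 1) * c 0) := by ring
      rw [h4] at h3
      exact pos_of_mul_pos_right h3 (sq_nonneg _)
  have hu : ∀ l < k, u l * c 0 = (-1) ^ l * c l * u 0 := by
    intro l
    induction l with
    | zero => intro _; ring
    | succ l ih =>
      intro hl
      have h1 := ih (by omega)
      obtain ⟨h2, h3⟩ := h l hl
      refine mul_left_cancel₀ (left_ne_zero_of_mul h2.ne) ?_
      linear_combination c 0 * h3 - c (l + 1) * h1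
  set W := ∑ l ∈ Finset.range k, (-1) ^ l * c l with hW
  have hW0 : W ≠ 0 := by
    have : 0 < W * c 0 := by
      rw [hW, Finset.sum_mul]
      exact Finset.sum_pos (fun l hl => hpos l (Finset.mem_range.1 hl))
        ⟨0, Finset.mem_range.2 (by omega)⟩
    exact left_ne_zero_of_mul this.ne'
  have hU : (∑ l ∈ Finset.range k, u l) * c 0 = W * u 0 := by
    rw [hW, Finset.sum_mul, Finset.sum_mul]
    exact Finset.sum_congr rfl fun l hl => hu l (Finset.mem_range.1 hl)
  refine ⟨hW0, fun l hl => mul_right_cancel₀ hc0 ?_⟩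
  linear_combination W * hu l hl - (-1) ^ l * c l * hU

/-- Along a chain of inner vertices all slopes are determined by the ends of the chain. -/
lemma HasSlope.of_chain {R : Fin m → Stop} {θ : ℝ} (j : Fin m) {k : ℕ} (hk : 2 ≤ k)
    (hin : ∀ l, 0 < l → l < k → (R (j + l • 1)).IsInner) {N D : ℝ[X]} (hN : N.natDegree ≤ 3)
    (hD : D.natDegree ≤ 2)
    (h : ∀ t x, Follows R θ t x →
      D.eval t ≠ 0 ∧ dot (tilt θ t) (x (j + k • 1) - x j) * D.eval t = N.eval t)
    {l : ℕ} (hl : l < k) : HasSlope R θ (j + l • 1) := by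
  set W : ℝ[X] := ∑ l ∈ Finset.range k, C ((-1) ^ l) * sidePoly R θ (j + l • 1) with hWdef
  have hWdeg : W.natDegree ≤ 1 := natDegree_sum_le_of_forall_le _ _ fun l _ =>
    (natDegree_mul_le_of_le (natDegree_C _).le (natDegree_sidePoly_le R θ _)).trans (by norm_num)
  -- The unfolded chain has slope `N / (D * W)`. These polynomials are `1` plus the squared slope,
  -- divided by `1 + t ^ 2`, after clearing denominators.
  refine ⟨N ^ 2 + W ^ 2 * D ^ 2, (1 + X ^ 2) * (W ^ 2 * D ^ 2), ?_, ?_, fun t x hx => ?_⟩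
  · exact (natDegree_add_le_of_degree_le (n := 6) (natDegree_pow_le_of_le 2 hN)
      (natDegree_mul_le_of_le (natDegree_pow_le_of_le 2 hWdeg) (natDegree_pow_le_of_le 2 hD)))
  · exact natDegree_mul_le_of_le natDegree_one_add_X_sq_le
      (natDegree_mul_le_of_le (natDegree_pow_le_of_le 2 hWdeg) (natDegree_pow_le_of_le 2 hD))
  · obtain ⟨hD0, hU⟩ := h t x hx
    have hstep : ∀ l : ℕ, j + l • 1 + 1 = j + (l + 1) • 1 := fun l => by
      rw [succ_nsmul, add_assoc]
    set c : ℕ → ℝ := fun l => cross (tilt θ t) (x (j + (l + 1) • 1) - x (j + l • 1)) with hc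
    set u : ℕ → ℝ := fun l => dot (tilt θ t) (x (j + (l + 1) • 1) - x (j + l • 1)) with hu
    have hrefl : ∀ l, l + 1 < k → c l * c (l + 1) < 0 ∧ u l * c (l + 1) + u (l + 1) * c l = 0 := by
      intro l hl
      have h1 := hx (j + (l + 1) • 1)
      have h2 := hin (l + 1) (by omega) hl
      generalize R (j + (l + 1) • 1) = s at h1 h2
      cases s with
      | point => exact h1.elim
      | stable w => exact h2.elim
      | farEnd v a b => exact h2.elim
      | inner v =>
        have h3 := h1.2
        rw [hstep, ← hstep l, add_sub_cancel_right, hstep l] at h3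
        exact h3
    obtain ⟨hW0, hslope⟩ := alternating_slope hk hrefl
    have hWt : W.eval t = ∑ l ∈ Finset.range k, (-1) ^ l * c l := by
      rw [hWdef, eval_finsetSum]
      refine Finset.sum_congr rfl fun l _ => ?_
      rw [eval_mul, eval_C, hx.eval_sidePoly, hstep]
    have hsum : ∑ l ∈ Finset.range k, u l = dot (tilt θ t) (x (j + k • 1) - x j) := by
      simp only [hu, dot_sub]
      rw [Finset.sum_range_sub (fun l => dot (tilt θ t) (x (j + l • 1)))]
      simp
    have hl' := hslope l hl
    rw [← hWt] at hW0 hl'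
    rw [hsum] at hl'
    have hd := dist_sq_mul_eq θ t (x (j + l • 1)) (x (j + (l + 1) • 1))
    simp only [eval_add, eval_mul, eval_pow, eval_one, eval_X]
    rw [hstep]
    refine ⟨by positivity, ?_⟩
    change _ = u l ^ 2 + c l ^ 2 at hd
    change _ = c l ^ 2 * _
    have hpm : ((-1 : ℝ) ^ l) ^ 2 = 1 := by rw [← pow_mul, mul_comm, pow_mul]; norm_num
    rw [← hU]
    generalize dot (tilt θ t) (x (j + k • 1) - x j) = U at *
    have hl2 : (u l * W.eval t) ^ 2 = c l ^ 2 * U ^ 2 := by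
      rw [hl', mul_pow, mul_pow, hpm, one_mul]
    linear_combination W.eval t ^ 2 * D.eval t ^ 2 * hd + D.eval t ^ 2 * hl2

/-- The maximal run of inner vertices around `i` ends at vertices that are not inner, possibly one
and the same. If every vertex is inner, the whole tour is a chain with net displacement zero. -/
lemma hasSlope_of_isInner {R : Fin m → Stop} (θ : ℝ) {i : Fin m} (hi : (R i).IsInner)
    (hm : 2 ≤ m) : HasSlope R θ i := by
  classical
  -- The cap `r = m` stops the backward search when all vertices are inner.
  have hex : ∃ r, 1 ≤ r ∧ (¬ (R (i - r • 1)).IsInner ∨ r = m) := ⟨m, by omega, Or.inr rfl⟩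
  obtain ⟨hr1, hr⟩ := Nat.find_spec hex
  have hrmin := fun l hl => Nat.find_min hex (m := l) hl
  have hrm : Nat.find hex ≤ m := Nat.find_min' hex ⟨by omega, Or.inr rfl⟩
  generalize Nat.find hex = r at *
  have hback : ∀ l, 0 < l → l < r → (R (i - l • 1)).IsInner := by
    intro l h0 hl
    have := hrmin l hl
    by_contra hcon
    exact this ⟨h0, Or.inl hcon⟩
  by_cases hfix : (R (i - r • 1)).IsInner
  · obtain rfl : r = m := hr.resolve_left (not_not.2 hfix)
    have h := HasSlope.of_chain (R := R) (θ := θ) i hm (N := 0) (D := 1) (l := 0) (fun l h0 hl => ?_)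
      (by simp) (by simp) (fun t x _ => ?_) (by omega)
    · simpa using h
    · have := hback (r - l) (by omega) (by omega)
      have e : (i + l • 1 : Fin r) = i - (r - l) • 1 := by
        rw [eq_sub_iff_add_eq, add_assoc, ← add_nsmul, show l + (r - l) = r by omega,
          card_nsmul_one, add_zero]
      rwa [e]
    · rw [card_nsmul_one, add_zero, sub_self]
      simp [dot]
  · have hrm' : r < m := by
      refine lt_of_le_of_ne hrm fun h => hfix ?_
      rw [h, card_nsmul_one, sub_zero]
      exact hi
    have hex' : ∃ s, 1 ≤ s ∧ ¬ (R (i + s • 1)).IsInner := by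
      refine ⟨m - r, by omega, ?_⟩
      have e : (i + (m - r) • 1 : Fin m) = i - r • 1 := by
        rw [eq_sub_iff_add_eq, add_assoc, ← add_nsmul, show m - r + r = m by omega,
          card_nsmul_one, add_zero]
      rwa [e]
    obtain ⟨hs1, hs⟩ := Nat.find_spec hex'
    have hsmin := fun l hl => Nat.find_min hex' (m := l) hl
    generalize Nat.find hex' = s at *
    have e : (i - r • 1 + (r + s) • 1 : Fin m) = i + s • 1 := by
      rw [add_nsmul, ← add_assoc, sub_add_cancel]
    obtain ⟨N, D, hN, hD, h⟩ := Follows.exists_dot_sub_mul_eq R θ hfix hs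
    have h := HasSlope.of_chain (R := R) (θ := θ) (i - r • 1) (k := r + s) (by omega) (l := r)
      (fun l h0 hl => ?_) hN hD (by rwa [e]) (by omega)
    · rwa [sub_add_cancel] at h
    · rcases lt_trichotomy l r with hlr | rfl | hlr
      · obtain ⟨q, rfl⟩ := Nat.exists_eq_add_of_lt hlr
        have e' : (i - (l + q + 1) • 1 + l • 1 : Fin m) = i - (q + 1) • 1 := by
          rw [add_assoc l, add_nsmul 1 l]; abel
        rw [e']
        exact hback (q + 1) (by omega) (by omega)
      · rwa [sub_add_cancel]
      · obtain ⟨q, rfl⟩ := Nat.exists_eq_add_of_lt hlr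
        have e' : (i - r • 1 + (r + q + 1) • 1 : Fin m) = i + (q + 1) • 1 := by
          rw [add_assoc r, add_nsmul 1 r, ← add_assoc, sub_add_cancel]
        rw [e']
        by_contra hcon
        exact hsmin (q + 1) (by omega) ⟨by omega, hcon⟩

/-! ### The length of a tour that follows an itinerary -/

open scoped Classical in
/-- The sides that are accounted for at a moving vertex `i`: the one that leaves it, and the one
that enters it if that comes from a stable vertex. -/
lemma exists_isRootFun_dist_add {R : Fin m → Stop} (θ : ℝ) (hm : 2 ≤ m) (i : Fin m) :
    ∃ g h : (Fin m → Plane) → ℝ, IsRootFun (Follows R θ) 14 g ∧ IsRootFun (Follows R θ) 4 h ∧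
      ∀ t x, Follows R θ t x → g x + h x = dist (x i) (x (i + 1)) +
        if (R (i - 1)).IsMoving then 0 else dist (x (i - 1)) (x i) := by
  have hprev : ¬ (R (i - 1)).IsMoving → (R (i - 1) = Stop.point ∨
      ∃ w, R (i - 1) = Stop.stable w) := by
    intro h
    generalize R (i - 1) = s at h ⊢
    cases s with
    | point => exact Or.inl rfl
    | stable w => exact Or.inr ⟨w, rfl⟩
    | inner v => exact (h trivial).elim
    | farEnd v a b => exact (h trivial).elim
  by_cases hin : (R i).IsInner
  · have hs := hasSlope_of_isInner θ hin hm
    by_cases hp : (R (i - 1)).IsMoving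
    · exact ⟨_, _, hs.isRootFun_dist, IsRootFun.zero _ _, fun t x _ => by rw [if_pos hp]⟩
    · exact ⟨_, _, hs.isRootFun_dist_add_dist hin, IsRootFun.zero _ _,
        fun t x _ => by rw [if_neg hp, add_zero]⟩
  -- The leaving side takes the root of degree 14. An entering side from a stable vertex has degree
  -- 4 here, so it fits the other root.
  · have hout : IsRootFun (Follows R θ) 14 (fun x => dist (x i) (x (i + 1))) := by
      by_cases hnext : (R (i + 1)).IsInner
      · exact (HasSlope.of_inner hnext (hasSlope_of_isInner θ hnext hm)).isRootFun_dist
      · obtain ⟨N, D, hN, hD, h⟩ := Follows.exists_dot_sub_mul_eq R θ hin hnext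
        exact isRootFun_dist_of_dot hN hD (by norm_num) h
    by_cases hp : (R (i - 1)).IsMoving
    · exact ⟨_, _, hout, IsRootFun.zero _ _, fun t x _ => by rw [if_pos hp]⟩
    · rcases hprev hp with hpt | ⟨w, hw⟩
      · refine ⟨_, _, hout, IsRootFun.zero _ _, fun t x hx => ?_⟩
        have := hx (i - 1)
        rw [hpt] at this
        exact this.elim
      · obtain ⟨N, D, hN, hD, h⟩ := Follows.exists_dot_sub_mul_eq_of_stable R θ hw hin
        have hroot := isRootFun_dist_of_dot (i := i - 1) (D := 4) hN hD (by norm_num)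
          (by rwa [sub_add_cancel])
        refine ⟨_, _, hout, hroot, fun t x _ => ?_⟩
        rw [if_neg hp, sub_add_cancel]

open scoped Classical in
-- A side is charged to its start if that is moving, otherwise to its end if that is moving; the
-- last sum collects the sides with no moving endpoint.
lemma tourLength_eq_sum_moving (R : Fin m → Stop) (x : Fin m → Plane) :
    tourLength x = (∑ i ∈ Finset.univ.filter (fun i => (R i).IsMoving),
        (dist (x i) (x (i + 1)) +
          if (R (i - 1)).IsMoving then 0 else dist (x (i - 1)) (x i))) +
      ∑ i, if (R i).IsMoving ∨ (R (i - 1)).IsMoving then 0 else dist (x (i - 1)) (x i) := by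
  have h1 : tourLength x = (∑ i, if (R i).IsMoving then dist (x i) (x (i + 1)) else 0) +
      ∑ i, if (R i).IsMoving then 0 else dist (x i) (x (i + 1)) := by
    rw [tourLength, ← Finset.sum_add_distrib]
    exact Finset.sum_congr rfl fun i _ => by split_ifs <;> simp
  have h2 : (∑ i, if (R i).IsMoving then 0 else dist (x i) (x (i + 1))) =
      ∑ i, if (R (i - 1)).IsMoving then 0 else dist (x (i - 1)) (x i) := by
    rw [← Equiv.sum_comp (Equiv.subRight (1 : Fin m))]
    simp
  rw [h1, h2, Finset.sum_filter, ← Finset.sum_add_distrib, ← Finset.sum_add_distrib]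
  refine Finset.sum_congr rfl fun i _ => ?_
  by_cases h : (R i).IsMoving <;> by_cases h' : (R (i - 1)).IsMoving <;> simp [h, h']

lemma dist_eq_of_not_isMoving {R : Fin m → Stop} {θ t t' : ℝ} {x x' : Fin m → Plane}
    (hx : Follows R θ t x) (hx' : Follows R θ t' x') {i : Fin m} (hi : ¬ (R i).IsMoving) :
    x i = x' i := by
  have h := hx i
  have h' := hx' i
  generalize R i = s at h h' hi
  cases s with
  | point => exact h.elim
  | stable w => rw [show x i = w from h, show x' i = w from h']
  | inner v => exact (hi trivial).elim
  | farEnd v a b => exact (hi trivial).elim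

open scoped Classical in
/-- The change of the length in terms of constants determined by the itinerary. -/
lemma exists_tourLength_eq (R : Fin m → Stop) (θ : ℝ) (hm : 2 ≤ m) :
    ∃ a : ℕ → ℕ → ℝ, ∀ (x x' : Fin m → Plane) (ε : ℝ) (N : ℕ),
      Follows R θ 0 x → Follows R θ (Real.tan ε) x' →
      (Finset.univ.filter (fun i => (R i).IsMoving)).card ≤ N →
      (∀ k ∈ Finset.range N, GateTermDefined (a k) ε) ∧
        tourLength x' = tourLength x + ∑ k ∈ Finset.range N, gateTerm (a k) ε := by
  -- The constants are read off from a reference configuration chosen from `R` and `θ` alone, not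
  -- from the given tour.
  by_cases hex : ∃ x₀, Follows R θ 0 x₀
  swap
  · exact ⟨fun _ _ => 0, fun x x' ε N hx => (hex ⟨x, hx⟩).elim⟩
  obtain ⟨x₀, h₀⟩ := hex
  set M := Finset.univ.filter (fun i => (R i).IsMoving) with hM
  set F : (Fin m → Plane) → Fin m → ℝ := fun x i => dist (x i) (x (i + 1)) +
    if (R (i - 1)).IsMoving then 0 else dist (x (i - 1)) (x i) with hF
  have hgate : ∀ i : Fin m, ∃ b : ℕ → ℝ, ∀ ε x, Follows R θ (Real.tan ε) x →
      GateTermDefined b ε ∧ gateTerm b ε = F x i - F x₀ i := by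
    intro i
    obtain ⟨g, h, hg, hh, hgh⟩ := exists_isRootFun_dist_add (R := R) θ hm i
    obtain ⟨b, hb⟩ := exists_gateTerm_eq h₀ hg hh
    refine ⟨b, fun ε x hx => ⟨(hb ε x hx).1, ?_⟩⟩
    rw [(hb ε x hx).2]
    simp only [hF]
    rw [← hgh _ x hx, ← hgh _ x₀ h₀]
    ring
  choose b hb using hgate
  let a : ℕ → ℕ → ℝ := fun k =>
    if hk : k < M.card then b (M.equivFin.symm ⟨k, hk⟩ : M) else fun _ => 0
  have hsum : ∀ N ε, M.card ≤ N →
      ∑ k ∈ Finset.range N, gateTerm (a k) ε = ∑ i ∈ M, gateTerm (b i) ε := by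
    intro N ε hN
    rw [← Finset.sum_subset (Finset.range_subset_range.2 hN), Finset.sum_range,
      ← Finset.sum_coe_sort M, ← Equiv.sum_comp M.equivFin.symm]
    · refine Finset.sum_congr rfl fun k _ => ?_
      simp only [a]
      rw [dif_pos k.is_lt]
    · intro k _ hk
      simp only [a]
      rw [dif_neg (by simpa using hk)]
      exact (gateTerm_zero ε).2
  have hlen : ∀ t x, Follows R θ t x →
      tourLength x = tourLength x₀ + ∑ i ∈ M, (F x i - F x₀ i) := by
    intro t x hx
    rw [tourLength_eq_sum_moving R x, tourLength_eq_sum_moving R x₀, Finset.sum_sub_distrib]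
    have : ∀ i, (if (R i).IsMoving ∨ (R (i - 1)).IsMoving then 0 else dist (x (i - 1)) (x i)) =
        if (R i).IsMoving ∨ (R (i - 1)).IsMoving then 0 else dist (x₀ (i - 1)) (x₀ i) := by
      intro i
      split_ifs with h
      · rfl
      · rw [not_or] at h
        rw [dist_eq_of_not_isMoving hx h₀ h.1, dist_eq_of_not_isMoving hx h₀ h.2]
    simp only [this, hF, hM]
    ring
  refine ⟨a, fun x x' ε N hx hx' hN => ⟨fun k _ => ?_, ?_⟩⟩
  · by_cases hk : k < M.card
    · have := (hb (M.equivFin.symm ⟨k, hk⟩ : M) ε x' hx').1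
      simpa only [a, dif_pos hk] using this
    · simpa only [a, dif_neg hk] using (gateTerm_zero ε).1
  -- Configurations at `t = 0` need not be unique, but each contribution is the same for all of
  -- them, as the gate term at `ε = 0` shows.
  · have hzero : ∑ i ∈ M, (F x i - F x₀ i) = 0 := by
      refine Finset.sum_eq_zero fun i _ => ?_
      have h1 := (hb i 0 x (by rwa [Real.tan_zero])).2
      have h2 := (hb i 0 x₀ (by rwa [Real.tan_zero])).2
      rw [← h1, h2, sub_self]
    rw [hsum N ε hN, hlen _ x hx, hlen _ x' hx', hzero, add_zero]
    congr 1
    exact Finset.sum_congr rfl fun i _ => ((hb i ε x' hx').2).symm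

/-! ### Tours with the same itinerary -/

open scoped Classical in
-- The gates of the moving vertices are visited and pairwise distinct. Finiteness of the set of cut
-- names is needed, since `Set.ncard` of an infinite set is zero.
lemma IsItinerary.card_moving_le {P : SimplePolygon n} {θ : ℝ} {T : Fin m → Plane}
    {R : Fin m → Stop} (h : IsItinerary P θ T R) :
    (Finset.univ.filter (fun i => (R i).IsMoving)).card ≤ (visitedGates P θ T).ncard := by
  obtain ⟨-, g, hg, hdesc⟩ := h
  have : Finite CutSide := Finite.of_injective
    (fun s : CutSide => match s with | CutSide.forward => true | CutSide.backward => false)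
    (by intro s s' h; cases s <;> cases s' <;> simp_all)
  rw [← Set.ncard_coe_finset]
  refine Set.ncard_le_ncard_of_injOn g (fun i hi => ?_) (hg.mono fun i hi => by simpa using hi)
    (Set.toFinite _)
  have hd := hdesc i
  have hi : (R i).IsMoving := by simpa using hi
  generalize R i = s at hd hi
  cases s with
  | point => exact hi.elim
  | stable w => exact hi.elim
  | inner v => exact hd.2.1
  | farEnd v a b => exact hd.2.1

lemma tourLength_comp_add (T : Fin m → Plane) (k : Fin m) :
    tourLength (fun i => T (i + k)) = tourLength T := by
  rw [tourLength, tourLength,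
    ← Equiv.sum_comp (Equiv.addRight k) (fun i => dist (T i) (T (i + 1)))]
  exact Finset.sum_congr rfl fun i _ => by simp [add_right_comm]

lemma Obeys.comp_add {d : Plane} {x : Fin m → Plane} {i k : Fin m} {s : Stop}
    (h : Obeys d x (i + k) s) : Obeys d (fun i => x (i + k)) i s := by
  cases s with
  | point => exact h
  | stable w => exact h
  | farEnd v a b => exact h
  | inner v =>
    have e1 : i + k - 1 = i - 1 + k := by abel
    have e2 : i + k + 1 = i + 1 + k := by abel
    rw [Obeys, e1, e2] at h
    exact h

lemma tourLength_eq_zero_of_eq_one (hm : m = 1) (T : Fin m → Plane) : tourLength T = 0 := by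
  subst hm
  simp [tourLength]

end MonotoneWatchman
end

open MonotoneWatchman
theorem mainTheorem2 :
    ∃ A : (m : ℕ) → (Fin m → Stop) → ℝ → ℕ → ℕ → ℝ,
      ∀ (n : ℕ) [NeZero n] (P : SimplePolygon n) (θ ε : ℝ) (m : ℕ) [NeZero m]
        (T T' : Fin m → Plane) (R R' : Fin m → Stop),
        Real.cos ε ≠ 0 →
        IsShortestWatchmanTour P θ T →
        IsShortestWatchmanTour P (θ + ε) T' →
        IsItinerary P θ T R →
        IsItinerary P (θ + ε) T' R' →
        Close P θ (θ + ε) T R T' R' →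
        (∀ k ∈ Finset.range (visitedGates P θ T).ncard, GateTermDefined (A m R θ k) ε) ∧
        tourLength T' = tourLength T +
          ∑ k ∈ Finset.range (visitedGates P θ T).ncard, gateTerm (A m R θ k) ε := by
  classical
  -- The constants are fixed before the polygon, the tours and `ε`. The instance is quantified after
  -- them, so that `choose` gives a function of `m`, `R` and `θ` only.
  have key : ∀ (m : ℕ) (R : Fin m → Stop) (θ : ℝ), ∃ a : ℕ → ℕ → ℝ, ∀ [NeZero m],
      (m = 1 → a = fun _ _ => 0) ∧
      (2 ≤ m → ∀ (x x' : Fin m → Plane) (ε : ℝ) (N : ℕ),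
        Follows R θ 0 x → Follows R θ (Real.tan ε) x' →
        (Finset.univ.filter (fun i => (R i).IsMoving)).card ≤ N →
        (∀ k ∈ Finset.range N, GateTermDefined (a k) ε) ∧
          tourLength x' = tourLength x + ∑ k ∈ Finset.range N, gateTerm (a k) ε) := by
    intro m R θ
    by_cases hm : 2 ≤ m
    · have : NeZero m := ⟨by omega⟩
      obtain ⟨a, ha⟩ := exists_tourLength_eq R θ hm
      exact ⟨a, fun {_} => ⟨fun h => by omega, fun _ => ha⟩⟩
    · exact ⟨fun _ _ => 0, fun {_} => ⟨fun _ => rfl, fun h => (hm h).elim⟩⟩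
  choose A hA using key
  refine ⟨A, ?_⟩
  intro n _ P θ ε m _ T T' R R' hε hT hT' hR hR' hclose
  obtain ⟨hA1, hA2⟩ := hA m R θ
  have hm0 : m ≠ 0 := NeZero.ne m
  by_cases hm : m = 1
  · rw [hA1 hm, tourLength_eq_zero_of_eq_one hm, tourLength_eq_zero_of_eq_one hm]
    exact ⟨fun k _ => (gateTerm_zero ε).1, by simp [(gateTerm_zero ε).2]⟩
  · have hm2 : 2 ≤ m := by omega
    obtain ⟨⟨k, hk⟩, -, -⟩ := hclose
    obtain ⟨g, -, hdesc⟩ := hR.2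
    obtain ⟨g', -, hdesc'⟩ := hR'.2
    have hx : Follows R θ 0 T := fun i => by
      rw [tilt_zero]
      exact hT.obeys hm2 (hR.1.resolve_left hm) (hdesc i)
    -- Undoing the cyclic shift `k` between the itineraries lets both tours follow the same `R`.
    have hx' : Follows R θ (Real.tan ε) (fun i => T' (i + -k)) := fun i => by
      have h := hT'.obeys hm2 (hR'.1.resolve_left hm) (hdesc' (i + -k))
      rw [hk, neg_add_cancel_right, dir_add_eq_smul_tilt θ hε] at h
      exact (h.of_smul hε).comp_add
    have := hA2 hm2 T _ ε _ hx hx' hR.card_moving_le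
    rwa [tourLength_comp_add] at this
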